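/- Let $G$ be a discrete group and let $A$ be a $C^*$-algebra. Write $C^*(G)$ for the full group $C^*$-algebra of $G$, identify $s\in G$ with its canonical image in $C^*(G)$, and let $\otimes$ denote the maximal $C^*$-tensor product (this is the only $C^*$-tensor product when one of the factors is nuclear). Let $\delta_G:C^*(G)\to C^*(G)\otimes C^*(G)$ be the comultiplication $s\mapsto s\otimes s$. A coaction of $G$ on $A$ is an injective $*$-homomorphism $\delta:A\to A\otimes C^*(G)$ which is nondegenerate, i.e. $\operatorname{span}\,\delta(A)(A\otimes C^*(G))$ is dense in $A\otimes C^*(G)$, and satisfies $(\delta\otimes\operatorname{id})\circ\delta=(\operatorname{id}\otimes\delta_G)\circ\delta$. For $s\in G$ put $A_s=\{a\in A:\delta(a)=a\otimes s\}$; the fixed point algebra of $\delta$ is $A^\delta=A_{1}$, where $1$ is the identity of $G$. Let $\chi_t\in C_0(G)$ be the characteristic function of $\{t\}$. A covariant representation of $(A,G,\delta)$ is a pair $(\pi,\mu)$ of nondegenerate representations of $A$ and $C_0(G)$ on a Hilbert space such that $\pi(a)\mu(\chi_t)=\mu(\chi_{st})\pi(a)$ for all $s,t\in G$ and $a\in A_s$.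 The crossed product $A\times_\delta G$ is the $C^*$-algebra generated by the products $j_A(a)j_G(f)$, $a\in A$, $f\in C_0(G)$, where $(j_A,j_G)$ is the universal covariant representation, i.e. the direct sum of all covariant representations. Let $\delta$ be a coaction of $G$ on $A$. Then the set $j_G(\chi_1)(A\times_\delta G)j_G(\chi_1)$ is a $*$-subalgebra of $A\times_\delta G$ (a corner), and the fixed point algebra $A^\delta$ is $*$-isomorphic to it. -/

import Mathlib

open scoped TensorProduct ENNReal ZeroAtInfty

noncomputable section

namespace DiscreteCoaction

universe u v w

/-! ### C*-seminorms and the associated Hausdorff completions -/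

/-- A C*-seminorm on a complex (not necessarily unital) *-algebra. -/
structure CStarSeminorm (R : Type u) [NonUnitalRing R] [StarRing R] [Module ℂ R] where
  toSeminorm : Seminorm ℂ R
  mul_le : ∀ x y, toSeminorm (x * y) ≤ toSeminorm x * toSeminorm y
  star_mul_self : ∀ x, toSeminorm (star x * x) = toSeminorm x * toSeminorm x

namespace CStarSeminorm

section Basic

variable {R : Type u} [NonUnitalRing R] [StarRing R] [Module ℂ R]

instance : CoeFun (CStarSeminorm R) (fun _ => R → ℝ) := ⟨fun p => p.toSeminorm⟩

theorem nonneg (p : CStarSeminorm R) (x : R) : 0 ≤ p x := apply_nonneg p.toSeminorm x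

theorem le_star (p : CStarSeminorm R) (x : R) : p x ≤ p (star x) := by
  rcases (p.nonneg x).eq_or_lt with h | h
  · rw [← h]; exact p.nonneg _
  · have h1 := p.star_mul_self x
    have h2 := p.mul_le (star x) x
    rw [h1] at h2
    exact le_of_mul_le_mul_right h2 h

theorem map_star (p : CStarSeminorm R) (x : R) : p (star x) = p x :=
  le_antisymm (by simpa using p.le_star (star x)) (p.le_star x)

/-- The zero C*-seminorm. -/
def zero : CStarSeminorm R where
  toSeminorm := 0
  mul_le _ _ := by simp
  star_mul_self _ := by simp

/-- The pullback of the norm of a C*-algebra along a *-homomorphism. -/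
def comap {D : Type v} [NonUnitalCStarAlgebra D] (f : R →⋆ₙₐ[ℂ] D) : CStarSeminorm R where
  toSeminorm := Seminorm.of (fun x => ‖f x‖)
    (fun x y => by rw [map_add]; exact norm_add_le _ _)
    (fun c x => by rw [map_smul, norm_smul])
  mul_le x y := by
    change ‖f (x * y)‖ ≤ ‖f x‖ * ‖f y‖
    rw [map_mul]; exact norm_mul_le _ _
  star_mul_self x := by
    change ‖f (star x * x)‖ = ‖f x‖ * ‖f x‖
    rw [map_mul, StarHomClass.map_star, CStarRing.norm_star_mul_self]

/-- The pointwise supremum of a nonempty, pointwise bounded set of C*-seminorms. -/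
def sup (S : Set (CStarSeminorm R)) (hS : S.Nonempty)
    (hb : ∀ x, ∃ C : ℝ, ∀ p ∈ S, p x ≤ C) : CStarSeminorm R :=
  have : Nonempty S := hS.to_subtype
  have bdd : ∀ x, BddAbove (Set.range fun p : S => p.1 x) := fun x => by
    obtain ⟨C, hC⟩ := hb x
    exact ⟨C, by rintro _ ⟨p, rfl⟩; exact hC p.1 p.2⟩
  have nn : ∀ x, 0 ≤ ⨆ p : S, p.1 x := fun x => Real.iSup_nonneg fun p => p.1.nonneg x
  { toSeminorm := Seminorm.of (fun x => ⨆ p : S, p.1 x)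
      (fun x y => ciSup_le fun p => (map_add_le_add p.1.toSeminorm x y).trans
        (add_le_add (le_ciSup (bdd x) p) (le_ciSup (bdd y) p)))
      (fun c x => by
        rw [Real.mul_iSup_of_nonneg (norm_nonneg c)]
        exact iSup_congr fun p => map_smul_eq_mul p.1.toSeminorm c x)
    mul_le := fun x y => ciSup_le fun p => (p.1.mul_le x y).trans
      (mul_le_mul (le_ciSup (bdd x) p) (le_ciSup (bdd y) p) (p.1.nonneg y) (nn x))
    star_mul_self := fun x => by
      change (⨆ p : S, p.1 (star x * x)) = (⨆ p : S, p.1 x) * ⨆ p : S, p.1 x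
      apply le_antisymm
      · refine ciSup_le fun p => ?_
        rw [p.1.star_mul_self]
        exact mul_le_mul (le_ciSup (bdd x) p) (le_ciSup (bdd x) p) (p.1.nonneg x) (nn x)
      · have h0 := nn (star x * x)
        have : (⨆ p : S, p.1 x) ≤ √(⨆ p : S, p.1 (star x * x)) := by
          refine ciSup_le fun p => Real.le_sqrt_of_sq_le ?_
          rw [sq, ← p.1.star_mul_self]
          exact le_ciSup (bdd (star x * x)) p
        calc _ ≤ √(⨆ p : S, p.1 (star x * x)) * √(⨆ p : S, p.1 (star x * x)) :=
              mul_le_mul this this (nn x) (Real.sqrt_nonneg _)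
          _ = _ := Real.mul_self_sqrt h0 }

theorem le_sup {S : Set (CStarSeminorm R)} (hS : S.Nonempty)
    (hb : ∀ x, ∃ C : ℝ, ∀ p ∈ S, p x ≤ C) {p : CStarSeminorm R} (hp : p ∈ S) (x : R) :
    p x ≤ sup S hS hb x := by
  obtain ⟨C, hC⟩ := hb x
  exact le_ciSup (f := fun p : S => p.1 x)
    ⟨C, by rintro _ ⟨p, rfl⟩; exact hC p.1 p.2⟩ ⟨p, hp⟩

theorem sup_le {S : Set (CStarSeminorm R)} (hS : S.Nonempty)
    (hb : ∀ x, ∃ C : ℝ, ∀ p ∈ S, p x ≤ C) {x : R} {c : ℝ} (h : ∀ p ∈ S, p x ≤ c) :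
    sup S hS hb x ≤ c :=
  have : Nonempty S := hS.to_subtype
  ciSup_le fun p : S => h p.1 p.2

end Basic

section Completion

variable {R : Type u} [NonUnitalRing R] [StarRing R] [Module ℂ R]

/-- The *-algebra `R`, regarded as a seminormed *-algebra through `N`. -/
def Pre (_N : CStarSeminorm R) : Type u := R

variable (N : CStarSeminorm R)

instance : NonUnitalSeminormedRing N.Pre :=
  { N.toSeminorm.toAddGroupSeminorm.toSeminormedAddCommGroup, (inferInstance : NonUnitalRing R) with
    norm_mul_le := N.mul_le }

theorem pre_norm (x : N.Pre) : ‖x‖ = N x := rfl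

instance : StarRing N.Pre := inferInstanceAs (StarRing R)

instance : NormedSpace ℂ N.Pre :=
  { (inferInstance : Module ℂ R) with
    norm_smul_le := fun c x => (map_smul_eq_mul N.toSeminorm c x).le }

instance : NormedStarGroup N.Pre where
  norm_star_le x := (N.map_star x).le

/-- The Hausdorff completion of `R` in the C*-seminorm `N`. -/
def Compl : Type u := UniformSpace.Completion N.Pre

instance : NormedAddCommGroup N.Compl :=
  inferInstanceAs (NormedAddCommGroup (UniformSpace.Completion N.Pre))
instance : NormedSpace ℂ N.Compl :=
  inferInstanceAs (NormedSpace ℂ (UniformSpace.Completion N.Pre))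
instance : CompleteSpace N.Compl :=
  inferInstanceAs (CompleteSpace (UniformSpace.Completion N.Pre))

/-- The canonical map from `R` to its completion. -/
def toCompl : R →ₗ[ℂ] N.Compl where
  toFun x := ((show N.Pre from x : N.Pre) : UniformSpace.Completion N.Pre)
  map_add' x y := UniformSpace.Completion.coe_add (α := N.Pre) x y
  map_smul' c x := UniformSpace.Completion.coe_smul (X := N.Pre) c x

theorem norm_toCompl (x : R) : ‖N.toCompl x‖ = N x :=
  UniformSpace.Completion.norm_coe (E := N.Pre) x

theorem denseRange_toCompl : DenseRange N.toCompl :=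
  UniformSpace.Completion.denseRange_coe (α := N.Pre)

variable {N} in
@[elab_as_elim]
theorem induction_on {P : N.Compl → Prop} (x : N.Compl) (hc : IsClosed {x | P x})
    (h : ∀ x : R, P (N.toCompl x)) : P x :=
  UniformSpace.Completion.induction_on (α := N.Pre) x hc h

/-- A linear map that is bounded for `N` extends to the completion. -/
def extendL {D : Type v} [NormedAddCommGroup D] [NormedSpace ℂ D] [CompleteSpace D]
    (f : R →ₗ[ℂ] D) (K : ℝ) (hf : ∀ x, ‖f x‖ ≤ K * N x) : N.Compl →L[ℂ] D :=
  (LinearMap.mkContinuous (show N.Pre →ₗ[ℂ] D from f) K hf).extend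
    (UniformSpace.Completion.toComplL : N.Pre →L[ℂ] UniformSpace.Completion N.Pre)

theorem extendL_toCompl {D : Type v} [NormedAddCommGroup D] [NormedSpace ℂ D] [CompleteSpace D]
    (f : R →ₗ[ℂ] D) (K : ℝ) (hf : ∀ x, ‖f x‖ ≤ K * N x) (x : R) :
    N.extendL f K hf (N.toCompl x) = f x :=
  ContinuousLinearMap.extend_eq
    (e := (UniformSpace.Completion.toComplL : N.Pre →L[ℂ] UniformSpace.Completion N.Pre)) _
    (UniformSpace.Completion.denseRange_coe) (UniformSpace.Completion.isUniformInducing_coe _) x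

theorem norm_extendL_le {D : Type v} [NormedAddCommGroup D] [NormedSpace ℂ D] [CompleteSpace D]
    (f : R →ₗ[ℂ] D) (K : ℝ) (hf : ∀ x, ‖f x‖ ≤ K * N x) (x : N.Compl) :
    ‖N.extendL f K hf x‖ ≤ K * ‖x‖ := by
  refine induction_on x (isClosed_le (by fun_prop) (by fun_prop)) fun x => ?_
  rw [extendL_toCompl, norm_toCompl]
  exact hf x

theorem ext_of_toCompl {D : Type v} [NormedAddCommGroup D] [NormedSpace ℂ D]
    {f g : N.Compl →L[ℂ] D} (h : ∀ x, f (N.toCompl x) = g (N.toCompl x)) : f = g :=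
  ContinuousLinearMap.ext fun x =>
    induction_on x (isClosed_eq f.continuous g.continuous) h

instance : Star N.Compl where
  star := UniformSpace.Completion.map (fun x : N.Pre => star x)

theorem uniformContinuous_star_pre : UniformContinuous (fun x : N.Pre => star x) :=
  (AddMonoidHomClass.isometry_of_norm (starAddEquiv : N.Pre ≃+ N.Pre)
    (fun x => norm_star x)).uniformContinuous

theorem toCompl_star (x : R) : N.toCompl (star x) = star (N.toCompl x) :=
  (UniformSpace.Completion.map_coe N.uniformContinuous_star_pre x).symm

instance : ContinuousStar N.Compl where
  continuous_star :=
    UniformSpace.Completion.continuous_map (f := fun x : N.Pre => star x)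

variable [IsScalarTower ℂ R R] [SMulCommClass ℂ R R]

/-- Multiplication on the completion, as a bounded bilinear map. -/
def mulL : N.Compl →L[ℂ] N.Compl →L[ℂ] N.Compl :=
  have h1 : ∀ x y : R, ‖(N.toCompl ∘ₗ LinearMap.mulLeft ℂ x) y‖ ≤ N x * N y := fun x y => by
    change ‖N.toCompl (x * y)‖ ≤ _
    rw [norm_toCompl]
    exact N.mul_le x y
  N.extendL
    { toFun := fun x => N.extendL (N.toCompl ∘ₗ LinearMap.mulLeft ℂ x) (N x) (h1 x)
      map_add' := fun x y => N.ext_of_toCompl fun z => by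
        simp [extendL_toCompl, add_mul]
      map_smul' := fun c x => N.ext_of_toCompl fun z => by
        simp [extendL_toCompl, smul_mul_assoc] }
    1 (fun x => by
      rw [one_mul]
      exact ContinuousLinearMap.opNorm_le_bound _ (N.nonneg x) (N.norm_extendL_le _ _ _))

instance : Mul N.Compl where
  mul x y := N.mulL x y

theorem toCompl_mul (x y : R) : N.toCompl (x * y) = N.toCompl x * N.toCompl y := by
  change _ = N.mulL (N.toCompl x) (N.toCompl y)
  simp [mulL, extendL_toCompl]

instance : ContinuousMul N.Compl where
  continuous_mul := by
    change Continuous fun p : N.Compl × N.Compl => N.mulL p.1 p.2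
    fun_prop

instance : NonUnitalNormedRing N.Compl :=
  { (inferInstance : NormedAddCommGroup N.Compl) with
    mul := fun x y => x * y
    zero_mul := fun x => show N.mulL 0 x = 0 by simp
    mul_zero := fun x => show N.mulL x 0 = 0 by simp
    left_distrib := fun x y z => (N.mulL x).map_add y z
    right_distrib := fun x y z => show N.mulL (x + y) z = N.mulL x z + N.mulL y z by simp
    mul_assoc := fun x y z => by
      change x * y * z = x * (y * z)
      refine induction_on x (isClosed_eq (by fun_prop) (by fun_prop)) fun x => ?_
      refine induction_on y (isClosed_eq (by fun_prop) (by fun_prop)) fun y => ?_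
      refine induction_on z (isClosed_eq (by fun_prop) (by fun_prop)) fun z => ?_
      simp only [← toCompl_mul, mul_assoc]
    norm_mul_le := fun x y => by
      change ‖x * y‖ ≤ ‖x‖ * ‖y‖
      refine induction_on x (isClosed_le (by fun_prop) (by fun_prop)) fun x => ?_
      refine induction_on y (isClosed_le (by fun_prop) (by fun_prop)) fun y => ?_
      rw [← toCompl_mul, norm_toCompl, norm_toCompl, norm_toCompl]
      exact N.mul_le x y }

instance : StarRing N.Compl where
  star_involutive x := by
    refine induction_on x (isClosed_eq (by fun_prop) (by fun_prop)) fun x => ?_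
    simp only [← toCompl_star, star_star]
  star_mul x y := by
    refine induction_on x (isClosed_eq (by fun_prop) (by fun_prop)) fun x => ?_
    refine induction_on y (isClosed_eq (by fun_prop) (by fun_prop)) fun y => ?_
    simp only [← toCompl_star, ← toCompl_mul, star_mul]
  star_add x y := by
    refine induction_on x (isClosed_eq (by fun_prop) (by fun_prop)) fun x => ?_
    refine induction_on y (isClosed_eq (by fun_prop) (by fun_prop)) fun y => ?_
    simp only [← toCompl_star, ← map_add, star_add]

instance : CStarRing N.Compl where
  norm_mul_self_le x := by
    refine induction_on x (isClosed_le (by fun_prop) (by fun_prop)) fun x => ?_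
    rw [← toCompl_star, ← toCompl_mul, norm_toCompl, norm_toCompl, N.star_mul_self]

instance : IsScalarTower ℂ N.Compl N.Compl where
  smul_assoc c x y := show N.mulL (c • x) y = c • N.mulL x y by simp

instance : SMulCommClass ℂ N.Compl N.Compl where
  smul_comm c x y := show c • N.mulL x y = N.mulL x (c • y) by simp

instance [StarModule ℂ R] : StarModule ℂ N.Compl where
  star_smul c x := by
    have h1 : Continuous fun x : N.Compl => star (c • x) :=
      (continuous_const_smul c).star
    have h2 : Continuous fun x : N.Compl => star c • star x :=
      continuous_star.const_smul (star c)
    refine induction_on x (isClosed_eq h1 h2) fun x => ?_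
    rw [← map_smul, ← toCompl_star, ← toCompl_star, star_smul, map_smul]

instance [StarModule ℂ R] : NonUnitalCStarAlgebra N.Compl where

/-- A *-homomorphism into a C*-algebra that is contractive for `N` extends to the completion. -/
def lift {D : Type v} [NonUnitalCStarAlgebra D] (f : R →⋆ₙₐ[ℂ] D) (hf : ∀ x, ‖f x‖ ≤ N x) :
    N.Compl →⋆ₙₐ[ℂ] D where
  __ := (N.extendL (f : R →ₗ[ℂ] D) 1 (by simpa using hf)).toLinearMap
  toFun := N.extendL (f : R →ₗ[ℂ] D) 1 (by simpa using hf)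
  map_zero' := map_zero _
  map_mul' x y := by
    refine induction_on x (isClosed_eq (by fun_prop) (by fun_prop)) fun x => ?_
    refine induction_on y (isClosed_eq (by fun_prop) (by fun_prop)) fun y => ?_
    simp only [← toCompl_mul, extendL_toCompl]
    exact map_mul f x y
  map_star' x := by
    refine induction_on x (isClosed_eq (by fun_prop) (by fun_prop)) fun x => ?_
    simp only [← toCompl_star, extendL_toCompl]
    exact StarHomClass.map_star f x

theorem lift_toCompl {D : Type v} [NonUnitalCStarAlgebra D] (f : R →⋆ₙₐ[ℂ] D)
    (hf : ∀ x, ‖f x‖ ≤ N x) (x : R) : N.lift f hf (N.toCompl x) = f x :=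
  extendL_toCompl N (f : R →ₗ[ℂ] D) 1 (by simpa using hf) x

end Completion

section Unital

variable {R : Type u} [Ring R] [StarRing R] [Algebra ℂ R] [StarModule ℂ R]

instance (N : CStarSeminorm R) : One N.Compl where
  one := N.toCompl 1

/-- The completion of a unital *-algebra is a unital normed ring. -/
@[reducible] def unitalRing (N : CStarSeminorm R) : NormedRing N.Compl :=
  { (inferInstance : NonUnitalNormedRing N.Compl) with
    one := 1
    one_mul := fun x => by
      change (1 : N.Compl) * x = x
      refine induction_on x (isClosed_eq (by fun_prop) (by fun_prop)) fun x => ?_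
      exact (N.toCompl_mul 1 x).symm.trans (by rw [one_mul])
    mul_one := fun x => by
      change x * (1 : N.Compl) = x
      refine induction_on x (isClosed_eq (by fun_prop) (by fun_prop)) fun x => ?_
      exact (N.toCompl_mul x 1).symm.trans (by rw [mul_one]) }

/-- The completion of a unital *-algebra is a unital C*-algebra. -/
@[reducible] def unitalCompl (N : CStarSeminorm R) : CStarAlgebra N.Compl :=
  letI ring : NormedRing N.Compl := N.unitalRing
  letI alg : NormedAlgebra ℂ N.Compl :=
    { Algebra.ofModule (fun c x y => smul_mul_assoc c x y) (fun c x y => mul_smul_comm c x y) with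
      norm_smul_le := norm_smul_le }
  { ring, alg, (inferInstance : StarRing N.Compl) with
    complete := (inferInstance : CompleteSpace N.Compl).complete
    norm_mul_self_le := (inferInstance : CStarRing N.Compl).norm_mul_self_le
    star_smul := (inferInstance : StarModule ℂ N.Compl).star_smul }

end Unital

end CStarSeminorm

/-! ### The full group C*-algebra of a discrete group -/

section GroupAlgebra

variable {G : Type v} [Group G]

/-- The involution `(∑ c_s s)* = ∑ (conj c_s) s⁻¹` of the complex group algebra. -/
instance : Star (MonoidAlgebra ℂ G) where
  star x := .ofCoeff ((x.coeff.mapRange star (star_zero ℂ)).equivMapDomain (Equiv.inv G))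

theorem star_single (s : G) (c : ℂ) :
    star (MonoidAlgebra.single s c) = MonoidAlgebra.single s⁻¹ (star c) := by
  change MonoidAlgebra.ofCoeff (((Finsupp.single s c).mapRange star (star_zero ℂ)).equivMapDomain
    (Equiv.inv G)) = MonoidAlgebra.ofCoeff (Finsupp.single s⁻¹ (star c))
  rw [Finsupp.mapRange_single, Finsupp.equivMapDomain_single]
  rfl

theorem coeff_star (x : MonoidAlgebra ℂ G) (s : G) : (star x).coeff s = star (x.coeff s⁻¹) := rfl

theorem groupAlgebra_star_add (x y : MonoidAlgebra ℂ G) : star (x + y) = star x + star y := by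
  ext s
  simp [coeff_star]

instance : StarRing (MonoidAlgebra ℂ G) where
  star_involutive x := by
    ext s
    simp [coeff_star]
  star_add := groupAlgebra_star_add
  star_mul x y := by
    induction x using MonoidAlgebra.induction_linear with
    | zero => simp [show star (0 : MonoidAlgebra ℂ G) = 0 by ext s; simp [coeff_star]]
    | add x₁ x₂ h₁ h₂ => rw [add_mul, groupAlgebra_star_add, groupAlgebra_star_add, h₁, h₂, mul_add]
    | single s c =>
      induction y using MonoidAlgebra.induction_linear with
      | zero => simp [show star (0 : MonoidAlgebra ℂ G) = 0 by ext s; simp [coeff_star]]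
      | add y₁ y₂ h₁ h₂ =>
        rw [mul_add, groupAlgebra_star_add, groupAlgebra_star_add, h₁, h₂, add_mul]
      | single t d =>
        simp [MonoidAlgebra.single_mul_single, star_single, mul_comm]

instance : StarModule ℂ (MonoidAlgebra ℂ G) where
  star_smul c x := by
    ext s
    simp [coeff_star]

theorem CStarSeminorm.groupAlgebra_single_le (p : CStarSeminorm (MonoidAlgebra ℂ G)) (s : G) :
    p (MonoidAlgebra.single s 1) ≤ 1 := by
  have h1 : p 1 ≤ 1 := by
    have h := p.star_mul_self 1
    rw [star_one, one_mul] at h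
    nlinarith [p.nonneg 1]
  have h2 := p.star_mul_self (MonoidAlgebra.single s 1)
  rw [star_single, MonoidAlgebra.single_mul_single, inv_mul_cancel, star_one, one_mul,
    ← MonoidAlgebra.one_def] at h2
  nlinarith [p.nonneg (MonoidAlgebra.single s 1)]

theorem CStarSeminorm.groupAlgebra_bounded (x : MonoidAlgebra ℂ G) :
    ∃ C : ℝ, ∀ p ∈ (Set.univ : Set (CStarSeminorm (MonoidAlgebra ℂ G))), p x ≤ C := by
  induction x using MonoidAlgebra.induction_linear with
  | zero => exact ⟨0, fun p _ => (map_zero p.toSeminorm).le⟩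
  | add x y hx hy =>
    obtain ⟨C, hC⟩ := hx
    obtain ⟨D, hD⟩ := hy
    exact ⟨C + D, fun p hp => (map_add_le_add p.toSeminorm x y).trans
      (add_le_add (hC p hp) (hD p hp))⟩
  | single s c =>
    refine ⟨‖c‖, fun p _ => ?_⟩
    have : MonoidAlgebra.single s c = c • MonoidAlgebra.single s (1 : ℂ) := by simp
    rw [this, map_smul_eq_mul]
    exact mul_le_of_le_one_right (norm_nonneg c) (p.groupAlgebra_single_le s)

variable (G)

/-- The largest C*-seminorm on the complex group algebra. -/
def groupNorm : CStarSeminorm (MonoidAlgebra ℂ G) :=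
  CStarSeminorm.sup Set.univ ⟨CStarSeminorm.zero, trivial⟩ CStarSeminorm.groupAlgebra_bounded

/-- The full group C*-algebra `C*(G)`: the completion of the complex group algebra in its largest
C*-seminorm. -/
def GroupCStar : Type v := (groupNorm G).Compl

instance : CStarAlgebra (GroupCStar G) := (groupNorm G).unitalCompl

variable {G}

/-- The canonical image of `s ∈ G` in `C*(G)`. -/
def groupU (s : G) : GroupCStar G := (groupNorm G).toCompl (MonoidAlgebra.single s 1)

theorem groupU_one : groupU (1 : G) = 1 := rfl

theorem groupU_mul (s t : G) : groupU (s * t) = groupU s * groupU t := by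
  have := (groupNorm G).toCompl_mul (MonoidAlgebra.single s 1) (MonoidAlgebra.single t 1)
  rw [MonoidAlgebra.single_mul_single, one_mul] at this
  exact this

theorem groupU_inv (s : G) : groupU s⁻¹ = star (groupU s) := by
  have := (groupNorm G).toCompl_star (MonoidAlgebra.single s 1)
  rw [star_single, star_one] at this
  exact this

section Lift

variable {D : Type w} [NonUnitalCStarAlgebra D] (u : G →ₙ* D) (hu : ∀ s, u s⁻¹ = star (u s))

/-- The linear extension to the group algebra of a map `u` from `G` to a C*-algebra with
`u (s t) = u s u t` and `u s⁻¹ = (u s)*`. -/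
def groupAlgLift : MonoidAlgebra ℂ G →⋆ₙₐ[ℂ] D :=
  { MonoidAlgebra.liftMagma ℂ u with
    map_star' := fun x => by
      change MonoidAlgebra.liftMagma ℂ u (star x) = star (MonoidAlgebra.liftMagma ℂ u x)
      induction x using MonoidAlgebra.induction_linear with
      | zero => simp
      | add x y hx hy => rw [star_add, map_add, map_add, star_add, hx, hy]
      | single s c => simp [star_single, hu] }

theorem norm_groupAlgLift_le (x : MonoidAlgebra ℂ G) : ‖groupAlgLift u hu x‖ ≤ groupNorm G x :=
  CStarSeminorm.le_sup (p := CStarSeminorm.comap (groupAlgLift u hu)) _ _ (Set.mem_univ _) x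

/-- The extension of `u` to a *-homomorphism of `C*(G)`. -/
def groupLift : GroupCStar G →⋆ₙₐ[ℂ] D :=
  (groupNorm G).lift (groupAlgLift u hu) (norm_groupAlgLift_le u hu)

theorem groupLift_groupU (s : G) : groupLift u hu (groupU s) = u s := by
  refine ((groupNorm G).lift_toCompl (groupAlgLift u hu) (norm_groupAlgLift_le u hu) _).trans ?_
  change MonoidAlgebra.liftMagma ℂ u (MonoidAlgebra.single s 1) = u s
  simp

end Lift

end GroupAlgebra

/-! ### The maximal tensor product -/

section MaxTensor

variable (A : Type u) (B : Type v) [NonUnitalCStarAlgebra A] [NonUnitalCStarAlgebra B]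

/-- The C*-seminorms on the algebraic tensor product with `p (a ⊗ b) ≤ ‖a‖ ‖b‖`. (Every C*-seminorm
on `A ⊗ B` has this property.) -/
def crossSeminorms : Set (CStarSeminorm (A ⊗[ℂ] B)) :=
  {p | ∀ (a : A) (b : B), p (a ⊗ₜ[ℂ] b) ≤ ‖a‖ * ‖b‖}

theorem crossSeminorms_bounded (x : A ⊗[ℂ] B) :
    ∃ C : ℝ, ∀ p ∈ crossSeminorms A B, p x ≤ C := by
  induction x using TensorProduct.induction_on with
  | zero => exact ⟨0, fun p _ => (map_zero p.toSeminorm).le⟩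
  | add x y hx hy =>
    obtain ⟨C, hC⟩ := hx
    obtain ⟨D, hD⟩ := hy
    exact ⟨C + D, fun p hp => (map_add_le_add p.toSeminorm x y).trans
      (add_le_add (hC p hp) (hD p hp))⟩
  | tmul a b => exact ⟨‖a‖ * ‖b‖, fun p hp => hp a b⟩

/-- The maximal C*-norm on the algebraic tensor product. -/
def maxNorm : CStarSeminorm (A ⊗[ℂ] B) :=
  CStarSeminorm.sup (crossSeminorms A B)
    ⟨CStarSeminorm.zero, fun a b => mul_nonneg (norm_nonneg a) (norm_nonneg b)⟩
    (crossSeminorms_bounded A B)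

/-- The maximal C*-tensor product `A ⊗ B`. -/
def MaxTensor : Type (max u v) := (maxNorm A B).Compl

instance : NonUnitalCStarAlgebra (MaxTensor A B) :=
  inferInstanceAs (NonUnitalCStarAlgebra (maxNorm A B).Compl)

variable {A B}

namespace MaxTensor

/-- The canonical map from the algebraic to the maximal tensor product. -/
def ofAlg : A ⊗[ℂ] B →ₗ[ℂ] MaxTensor A B := (maxNorm A B).toCompl

theorem ofAlg_mul (x y : A ⊗[ℂ] B) : ofAlg (x * y) = ofAlg x * ofAlg y :=
  (maxNorm A B).toCompl_mul x y

theorem ofAlg_star (x : A ⊗[ℂ] B) : ofAlg (star x) = star (ofAlg x) :=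
  (maxNorm A B).toCompl_star x

@[elab_as_elim]
theorem induction_on {P : MaxTensor A B → Prop} (x : MaxTensor A B) (hc : IsClosed {x | P x})
    (h : ∀ x : A ⊗[ℂ] B, P (ofAlg x)) : P x :=
  CStarSeminorm.induction_on (N := maxNorm A B) x hc h

/-- The elementary tensor `a ⊗ b`, bilinearly in `a` and `b`. -/
def tmulₗ : A →ₗ[ℂ] B →ₗ[ℂ] MaxTensor A B :=
  (TensorProduct.mk ℂ A B).compr₂ ofAlg

/-- The elementary tensor `a ⊗ b`. -/
def tmul (a : A) (b : B) : MaxTensor A B := tmulₗ a b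

theorem ofAlg_tmul (a : A) (b : B) : ofAlg (a ⊗ₜ[ℂ] b) = tmul a b := rfl

theorem tmul_mul (a a' : A) (b b' : B) : tmul a b * tmul a' b' = tmul (a * a') (b * b') := by
  rw [← ofAlg_tmul, ← ofAlg_tmul, ← ofAlg_mul, Algebra.TensorProduct.tmul_mul_tmul, ofAlg_tmul]

theorem star_tmul (a : A) (b : B) : star (tmul a b) = tmul (star a) (star b) := by
  rw [← ofAlg_tmul, ← ofAlg_star, TensorProduct.star_tmul, ofAlg_tmul]

theorem norm_tmul_le (a : A) (b : B) : ‖tmul a b‖ ≤ ‖a‖ * ‖b‖ :=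
  ((maxNorm A B).norm_toCompl _).le.trans
    (CStarSeminorm.sup_le _ _ fun _ hp => hp a b)

section Lift

variable {D : Type w} [NonUnitalCStarAlgebra D] (β : A →ₗ[ℂ] B →ₗ[ℂ] D)
  (hmul : ∀ a a' b b', β a b * β a' b' = β (a * a') (b * b'))
  (hstar : ∀ a b, star (β a b) = β (star a) (star b))

/-- The *-homomorphism on the algebraic tensor product given by a multiplicative and *-preserving
bilinear map. -/
def algLift : A ⊗[ℂ] B →⋆ₙₐ[ℂ] D where
  __ := TensorProduct.lift β
  toFun := TensorProduct.lift β
  map_zero' := map_zero _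
  map_mul' x y := by
    induction x using TensorProduct.induction_on with
    | zero => simp
    | add x₁ x₂ h₁ h₂ => rw [add_mul, map_add, map_add, add_mul, h₁, h₂]
    | tmul a b =>
      induction y using TensorProduct.induction_on with
      | zero => simp
      | add y₁ y₂ h₁ h₂ => rw [mul_add, map_add, map_add, mul_add, h₁, h₂]
      | tmul a' b' => simp [Algebra.TensorProduct.tmul_mul_tmul, hmul]
  map_star' x := by
    induction x using TensorProduct.induction_on with
    | zero => simp
    | add x y hx hy => rw [star_add, map_add, map_add, star_add, hx, hy]
    | tmul a b => simp [hstar]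

theorem norm_algLift_le (hnorm : ∀ a b, ‖β a b‖ ≤ ‖a‖ * ‖b‖) (x : A ⊗[ℂ] B) : ‖algLift β hmul hstar x‖ ≤ maxNorm A B x := by
  refine CStarSeminorm.le_sup (S := crossSeminorms A B)
    (p := CStarSeminorm.comap (algLift β hmul hstar)) _ _ (fun a b => ?_) x
  exact hnorm a b

/-- The extension of a multiplicative, *-preserving and contractive bilinear map to the maximal
tensor product. -/
def lift (hnorm : ∀ a b, ‖β a b‖ ≤ ‖a‖ * ‖b‖) : MaxTensor A B →⋆ₙₐ[ℂ] D :=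
  (maxNorm A B).lift (algLift β hmul hstar) (norm_algLift_le β hmul hstar hnorm)

theorem lift_tmul (hnorm : ∀ a b, ‖β a b‖ ≤ ‖a‖ * ‖b‖) (a : A) (b : B) : lift β hmul hstar hnorm (tmul a b) = β a b :=
  (maxNorm A B).lift_toCompl (algLift β hmul hstar) (norm_algLift_le β hmul hstar hnorm) _

end Lift

section Map

variable {A' B' : Type*} [NonUnitalCStarAlgebra A'] [NonUnitalCStarAlgebra B']

/-- The tensor product `φ ⊗ ψ` of two *-homomorphisms. -/
def map (φ : A →⋆ₙₐ[ℂ] A') (ψ : B →⋆ₙₐ[ℂ] B') : MaxTensor A B →⋆ₙₐ[ℂ] MaxTensor A' B' :=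
  lift (tmulₗ.compl₁₂ (φ : A →ₗ[ℂ] A') (ψ : B →ₗ[ℂ] B'))
    (fun a a' b b' => by
      change tmul (φ a) (ψ b) * tmul (φ a') (ψ b') = tmul (φ (a * a')) (ψ (b * b'))
      rw [tmul_mul, map_mul, map_mul])
    (fun a b => by
      change star (tmul (φ a) (ψ b)) = tmul (φ (star a)) (ψ (star b))
      rw [star_tmul, map_star, map_star])
    (fun a b => (norm_tmul_le (φ a) (ψ b)).trans
      (mul_le_mul (NonUnitalStarAlgHom.norm_apply_le φ a) (NonUnitalStarAlgHom.norm_apply_le ψ b)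
        (norm_nonneg _) (norm_nonneg _)))

theorem map_tmul (φ : A →⋆ₙₐ[ℂ] A') (ψ : B →⋆ₙₐ[ℂ] B') (a : A) (b : B) :
    map φ ψ (tmul a b) = tmul (φ a) (ψ b) :=
  lift_tmul _ _ _ _ a b

end Map

section Assoc

variable {C : Type w} [CStarAlgebra C]

/-- For `c ∈ C`, the linear map `a ⊗ b ↦ a ⊗ (b ⊗ c)` on the algebraic tensor product. -/
def legₗ (c : C) : A ⊗[ℂ] B →ₗ[ℂ] MaxTensor A (MaxTensor B C) :=
  TensorProduct.lift (tmulₗ.compl₂ (tmulₗ.flip c))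

theorem legₗ_tmul (c : C) (a : A) (b : B) : legₗ c (a ⊗ₜ[ℂ] b) = tmul a (tmul b c) := rfl

theorem legₗ_mul (c d : C) (x y : A ⊗[ℂ] B) :
    legₗ c x * legₗ d y = legₗ (c * d) (x * y) := by
  induction x using TensorProduct.induction_on with
  | zero => simp
  | add x₁ x₂ h₁ h₂ => rw [add_mul, map_add, map_add, add_mul, h₁, h₂]
  | tmul a b =>
    induction y using TensorProduct.induction_on with
    | zero => simp
    | add y₁ y₂ h₁ h₂ => rw [mul_add, map_add, map_add, mul_add, h₁, h₂]
    | tmul a' b' =>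
      simp only [Algebra.TensorProduct.tmul_mul_tmul, legₗ_tmul, tmul_mul]

theorem star_legₗ (c : C) (x : A ⊗[ℂ] B) : star (legₗ c x) = legₗ (star c) (star x) := by
  induction x using TensorProduct.induction_on with
  | zero => simp
  | add x y hx hy => rw [star_add, map_add, map_add, star_add, hx, hy]
  | tmul a b => simp only [TensorProduct.star_tmul, legₗ_tmul, star_tmul]

theorem legₗ_add (c d : C) (x : A ⊗[ℂ] B) : legₗ (c + d) x = legₗ c x + legₗ d x := by
  induction x using TensorProduct.induction_on with
  | zero => simp
  | add x y hx hy => rw [map_add, map_add, map_add, hx, hy]; abel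
  | tmul a b => simp only [legₗ_tmul, tmul, map_add]

theorem legₗ_smul (r : ℂ) (c : C) (x : A ⊗[ℂ] B) : legₗ (r • c) x = r • legₗ c x := by
  induction x using TensorProduct.induction_on with
  | zero => simp
  | add x y hx hy => rw [map_add, map_add, smul_add, hx, hy]
  | tmul a b => simp only [legₗ_tmul, tmul, map_smul]

theorem norm_legₗ_one_le (x : A ⊗[ℂ] B) : ‖legₗ (1 : C) x‖ ≤ maxNorm A B x := by
  let f : A ⊗[ℂ] B →⋆ₙₐ[ℂ] MaxTensor A (MaxTensor B C) :=
    { legₗ (1 : C) with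
      map_zero' := map_zero _
      map_mul' := fun x y => by
        change legₗ (1 : C) (x * y) = legₗ (1 : C) x * legₗ (1 : C) y
        rw [legₗ_mul, mul_one]
      map_star' := fun x => by
        change legₗ (1 : C) (star x) = star (legₗ (1 : C) x)
        rw [star_legₗ, star_one] }
  refine CStarSeminorm.le_sup (p := CStarSeminorm.comap f) _ _ (fun a b => ?_) x
  change ‖tmul a (tmul b (1 : C))‖ ≤ ‖a‖ * ‖b‖
  have h1 : ‖(1 : C)‖ ≤ 1 := by
    have := CStarRing.norm_star_mul_self (x := (1 : C))
    rw [star_one, one_mul] at this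
    nlinarith [norm_nonneg (1 : C)]
  refine (norm_tmul_le _ _).trans (mul_le_mul_of_nonneg_left ?_ (norm_nonneg a))
  exact (norm_tmul_le _ _).trans (mul_le_of_le_one_right (norm_nonneg b) h1)

open scoped CStarAlgebra in
theorem norm_legₗ_le (c : C) (x : A ⊗[ℂ] B) : ‖legₗ c x‖ ≤ ‖c‖ * maxNorm A B x := by
  let _ := CStarAlgebra.spectralOrder C
  have := CStarAlgebra.spectralOrderedRing C
  let _ := CStarAlgebra.spectralOrder (MaxTensor A (MaxTensor B C))
  have := CStarAlgebra.spectralOrderedRing (MaxTensor A (MaxTensor B C))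
  obtain ⟨e, he⟩ : ∃ e : C, ((‖c‖ ^ 2 : ℝ) : ℂ) • (1 : C) - star c * c = star e * e := by
    have : star c * c ≤ ((‖c‖ ^ 2 : ℝ) : ℂ) • (1 : C) := by
      have := CStarAlgebra.star_mul_le_algebraMap_norm_sq (a := c)
      rwa [Algebra.algebraMap_eq_smul_one, ← Complex.coe_smul] at this
    exact CStarAlgebra.nonneg_iff_eq_star_mul_self.mp (sub_nonneg.mpr this)
  have h1 : ((‖c‖ ^ 2 : ℝ) : ℂ) • (star (legₗ (1 : C) x) * legₗ (1 : C) x) -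
      star (legₗ c x) * legₗ c x = star (legₗ e x) * legₗ e x := by
    rw [star_legₗ, star_legₗ, star_legₗ, legₗ_mul, legₗ_mul, legₗ_mul, ← he, star_one, one_mul,
      sub_eq_add_neg, sub_eq_add_neg, legₗ_add, legₗ_smul, ← neg_one_smul ℂ (star c * c),
      legₗ_smul, neg_one_smul]
  have h2 : star (legₗ c x) * legₗ c x ≤
      ((‖c‖ ^ 2 : ℝ) : ℂ) • (star (legₗ (1 : C) x) * legₗ (1 : C) x) := by
    rw [← sub_nonneg, h1]
    exact star_mul_self_nonneg _
  have h3 := CStarAlgebra.norm_le_norm_of_nonneg_of_le (star_mul_self_nonneg _) h2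
  rw [norm_smul, CStarRing.norm_star_mul_self, CStarRing.norm_star_mul_self] at h3
  have h4 : ‖((‖c‖ ^ 2 : ℝ) : ℂ)‖ = ‖c‖ ^ 2 := by simp
  rw [h4] at h3
  have h5 : ‖legₗ c x‖ ≤ ‖c‖ * ‖legₗ (1 : C) x‖ := by
    refine abs_le_of_sq_le_sq' ?_ (by positivity) |>.2
    nlinarith
  exact h5.trans (mul_le_mul_of_nonneg_left (norm_legₗ_one_le x) (norm_nonneg c))

/-- For `c ∈ C`, the bounded linear map `a ⊗ b ↦ a ⊗ (b ⊗ c)`. -/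
def leg (c : C) : MaxTensor A B →L[ℂ] MaxTensor A (MaxTensor B C) :=
  (maxNorm A B).extendL (legₗ c) ‖c‖ (norm_legₗ_le c)

theorem leg_ofAlg (c : C) (x : A ⊗[ℂ] B) : leg c (ofAlg x) = legₗ c x :=
  (maxNorm A B).extendL_toCompl (legₗ c) ‖c‖ (norm_legₗ_le c) x

theorem leg_add (c d : C) (x : MaxTensor A B) : leg (c + d) x = leg c x + leg d x := by
  refine induction_on x (isClosed_eq (by fun_prop) (by fun_prop)) fun x => ?_
  rw [leg_ofAlg, leg_ofAlg, leg_ofAlg, legₗ_add]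

theorem leg_smul (r : ℂ) (c : C) (x : MaxTensor A B) : leg (r • c) x = r • leg c x := by
  refine induction_on x (isClosed_eq (by fun_prop) ((leg c).continuous.const_smul r)) fun x => ?_
  rw [leg_ofAlg, leg_ofAlg, legₗ_smul]

theorem leg_mul (c d : C) (x y : MaxTensor A B) : leg c x * leg d y = leg (c * d) (x * y) := by
  refine induction_on x (isClosed_eq (by fun_prop) (by fun_prop)) fun x => ?_
  refine induction_on y (isClosed_eq (by fun_prop) (by fun_prop)) fun y => ?_
  rw [← ofAlg_mul, leg_ofAlg, leg_ofAlg, leg_ofAlg, legₗ_mul]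

theorem star_leg (c : C) (x : MaxTensor A B) : star (leg c x) = leg (star c) (star x) := by
  refine induction_on x (isClosed_eq (by fun_prop) (by fun_prop)) fun x => ?_
  rw [← ofAlg_star, leg_ofAlg, leg_ofAlg, star_legₗ]

theorem norm_leg_le (c : C) (x : MaxTensor A B) : ‖leg c x‖ ≤ ‖x‖ * ‖c‖ := by
  rw [mul_comm]
  exact (maxNorm A B).norm_extendL_le (legₗ c) ‖c‖ (norm_legₗ_le c) x

/-- The bilinear map `(x, c) ↦ leg c x`. -/
def legBilin : MaxTensor A B →ₗ[ℂ] C →ₗ[ℂ] MaxTensor A (MaxTensor B C) :=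
  LinearMap.mk₂ ℂ (fun x c => leg c x) (fun x y _ => map_add _ x y) (fun r x _ => map_smul _ r x)
    (fun x c d => leg_add c d x) (fun r x c => leg_smul r c x)

/-- The canonical *-homomorphism `(A ⊗ B) ⊗ C → A ⊗ (B ⊗ C)`, for unital `C`. -/
def assoc : MaxTensor (MaxTensor A B) C →⋆ₙₐ[ℂ] MaxTensor A (MaxTensor B C) :=
  lift legBilin (fun x y c d => leg_mul c d x y) (fun x c => star_leg c x)
    (fun x c => norm_leg_le c x)

theorem assoc_tmul (a : A) (b : B) (c : C) :
    assoc (tmul (tmul a b) c) = tmul a (tmul b c) :=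
  (lift_tmul _ _ _ _ _ _).trans (leg_ofAlg c (a ⊗ₜ[ℂ] b))

end Assoc

end MaxTensor

end MaxTensor

/-! ### Coactions of a discrete group -/

section Coactions

variable (G : Type v) [Group G]

/-- The comultiplication `δ_G : C*(G) → C*(G) ⊗ C*(G)`, `s ↦ s ⊗ s`. -/
def comult : GroupCStar G →⋆ₙₐ[ℂ] MaxTensor (GroupCStar G) (GroupCStar G) :=
  groupLift
    { toFun := fun s => MaxTensor.tmul (groupU s) (groupU s)
      map_mul' := fun s t => by rw [MaxTensor.tmul_mul, groupU_mul] }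
    (fun s => by
      change MaxTensor.tmul (groupU s⁻¹) (groupU s⁻¹) = star (MaxTensor.tmul (groupU s) (groupU s))
      rw [MaxTensor.star_tmul, groupU_inv])

theorem comult_groupU (s : G) :
    comult G (groupU s) = MaxTensor.tmul (groupU s) (groupU s) :=
  groupLift_groupU _ _ s

/-- A coaction of the discrete group `G` on the C*-algebra `A`: an injective *-homomorphism
`δ : A → A ⊗ C*(G)` that is nondegenerate, `δ(A)(A ⊗ C*(G))` spanning a dense subspace, and
satisfies the coaction identity `(δ ⊗ id) ∘ δ = (id ⊗ δ_G) ∘ δ`. -/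
structure Coaction (A : Type u) [NonUnitalCStarAlgebra A] where
  toHom : A →⋆ₙₐ[ℂ] MaxTensor A (GroupCStar G)
  injective : Function.Injective toHom
  nondegenerate : Dense (Submodule.span ℂ
    {y : MaxTensor A (GroupCStar G) | ∃ a x, y = toHom a * x} : Set (MaxTensor A (GroupCStar G)))
  coassoc : ∀ a, MaxTensor.assoc (MaxTensor.map toHom (NonUnitalStarAlgHom.id ℂ _) (toHom a)) =
    MaxTensor.map (NonUnitalStarAlgHom.id ℂ A) (comult G) (toHom a)

variable {G} {A : Type u} [NonUnitalCStarAlgebra A] (δ : Coaction G A)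

namespace Coaction

/-- The spectral subspace `A_s = {a ∈ A : δ(a) = a ⊗ s}`. -/
def spectralSubspace (s : G) : Submodule ℂ A where
  carrier := {a | δ.toHom a = MaxTensor.tmul a (groupU s)}
  zero_mem' := by simp [MaxTensor.tmul]
  add_mem' {a b} ha hb := by
    simp only [Set.mem_ofPred_eq, MaxTensor.tmul, map_add, LinearMap.add_apply] at *
    rw [ha, hb]
  smul_mem' c a ha := by
    simp only [Set.mem_ofPred_eq, MaxTensor.tmul, map_smul, LinearMap.smul_apply] at *
    rw [ha]

/-- The fixed point algebra `A^δ = A_1`. -/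
def fixedPointAlgebra : NonUnitalStarSubalgebra ℂ A where
  __ := δ.spectralSubspace 1
  mul_mem' {a b} ha hb := by
    change δ.toHom a = MaxTensor.tmul a (groupU 1) at ha
    change δ.toHom b = MaxTensor.tmul b (groupU 1) at hb
    change δ.toHom (a * b) = MaxTensor.tmul (a * b) (groupU 1)
    rw [map_mul, ha, hb, MaxTensor.tmul_mul, ← groupU_mul, mul_one]
  star_mem' {a} ha := by
    change δ.toHom a = MaxTensor.tmul a (groupU 1) at ha
    change δ.toHom (star a) = MaxTensor.tmul (star a) (groupU 1)
    rw [map_star, ha, MaxTensor.star_tmul, ← groupU_inv, inv_one]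

end Coaction

/-! ### Covariant representations and the crossed product -/

/-- A representation on a Hilbert space is nondegenerate if the vectors `π(a) h` span a dense
subspace. -/
def IsNondegenerate {B : Type u} [NonUnitalCStarAlgebra B] {H : Type w} [NormedAddCommGroup H]
    [InnerProductSpace ℂ H] [CompleteSpace H] (π : B →⋆ₙₐ[ℂ] (H →L[ℂ] H)) : Prop :=
  Dense (Submodule.span ℂ {h : H | ∃ b k, h = π b k} : Set H)

/-- The characteristic function `χ_s` of `{s}`, as an element of `C₀(G)`. -/
def chi {G : Type v} [TopologicalSpace G] [DiscreteTopology G] (s : G) : C₀(G, ℂ) where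
  toFun := Set.indicator {s} 1
  continuous_toFun := continuous_of_discreteTopology
  zero_at_infty' := by
    refine tendsto_const_nhds.congr' ?_
    filter_upwards [(isCompact_singleton (x := s)).compl_mem_cocompact] with t ht
    exact (Set.indicator_of_notMem ht 1).symm

/-- A covariant representation `(π, μ)` of `(A, G, δ)` on a Hilbert space. -/
structure CovariantRep {G : Type v} [Group G] [TopologicalSpace G] [DiscreteTopology G]
    {A : Type u} [NonUnitalCStarAlgebra A] (δ : Coaction G A) where
  H : Type (max u v)
  [normedAddCommGroup : NormedAddCommGroup H]
  [innerProductSpace : InnerProductSpace ℂ H]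
  [completeSpace : CompleteSpace H]
  π : A →⋆ₙₐ[ℂ] (H →L[ℂ] H)
  μ : C₀(G, ℂ) →⋆ₙₐ[ℂ] (H →L[ℂ] H)
  nondegenerate_π : IsNondegenerate π
  nondegenerate_μ : IsNondegenerate μ
  covariant : ∀ (s t : G), ∀ a ∈ δ.spectralSubspace s, π a * μ (chi t) = μ (chi (s * t)) * π a

attribute [instance] CovariantRep.normedAddCommGroup CovariantRep.innerProductSpace
  CovariantRep.completeSpace

namespace Coaction

variable {G : Type v} [Group G] [TopologicalSpace G] [DiscreteTopology G]
  {A : Type u} [NonUnitalCStarAlgebra A] (δ : Coaction G A)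

/-- The C*-algebra `∏ B(H)` of bounded families of operators, indexed by all covariant
representations of `(A, G, δ)`. It acts, block-diagonally, on the Hilbert space direct sum of all
covariant representations. -/
def Ambient : Type (max u v + 1) :=
  lp (fun ρ : CovariantRep δ => ρ.H →L[ℂ] ρ.H) ∞

instance : NonUnitalCStarAlgebra δ.Ambient :=
  inferInstanceAs (NonUnitalCStarAlgebra (lp (fun ρ : CovariantRep δ => ρ.H →L[ℂ] ρ.H) ∞))

/-- The *-homomorphism into `∏ B(H)` given by a family of representations. -/
def family {B : Type w} [NonUnitalCStarAlgebra B]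
    (φ : ∀ ρ : CovariantRep δ, B →⋆ₙₐ[ℂ] (ρ.H →L[ℂ] ρ.H)) : B →⋆ₙₐ[ℂ] δ.Ambient where
  toFun b := ⟨fun ρ => φ ρ b, memℓp_infty ⟨‖b‖, by
    rintro _ ⟨ρ, rfl⟩
    exact NonUnitalStarAlgHom.norm_apply_le (φ ρ) b⟩⟩
  map_smul' c b := Subtype.ext <| funext fun ρ => map_smul (φ ρ) c b
  map_zero' := Subtype.ext <| funext fun ρ => map_zero (φ ρ)
  map_add' b c := Subtype.ext <| funext fun ρ => map_add (φ ρ) b c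
  map_mul' b c := Subtype.ext <| funext fun ρ => map_mul (φ ρ) b c
  map_star' b := Subtype.ext <| funext fun ρ => map_star (φ ρ) b

/-- The first component `j_A` of the universal covariant representation `(j_A, j_G)`: the direct
sum of the `π` over all covariant representations `(π, μ)`. -/
def jA : A →⋆ₙₐ[ℂ] δ.Ambient := δ.family fun ρ => ρ.π

/-- The second component `j_G` of the universal covariant representation `(j_A, j_G)`: the direct
sum of the `μ` over all covariant representations `(π, μ)`. -/
def jG : C₀(G, ℂ) →⋆ₙₐ[ℂ] δ.Ambient := δ.family fun ρ => ρ.μ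

/-- The crossed product `A ×_δ G`: the C*-algebra generated by the products `j_A(a) j_G(f)` of the
universal covariant representation. -/
def crossedProduct : NonUnitalStarSubalgebra ℂ δ.Ambient :=
  (NonUnitalStarAlgebra.adjoin ℂ
    {x : δ.Ambient | ∃ (a : A) (f : C₀(G, ℂ)), x = δ.jA a * δ.jG f}).topologicalClosure

end Coaction

end Coactions

end DiscreteCoaction

end

/-!
Let `a_s` be the slice of `δ(a)` by the coefficient functional of `C*(G)` at `s`. The coaction
identity gives `δ(a_s) = a_s ⊗ s`, and together with injectivity of `δ` it gives
`(id ⊗ ε)(δ(a)) = a` for the counit `ε`. Now apply `id ⊗ ω`, where `ω(s ⊗ t) = δ_{s,t}`, to both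
sides of the coaction identity at `a`: the right side yields `(id ⊗ ε)(δ(a)) = a`, the left side a
limit of linear combinations of slices `b_s`. So the spectral subspaces span a dense subspace of
`A`, and the crossed product is the closed span of the products `j_A(a) j_G(χ_r)` with `a ∈ A_s`.

With `p = j_G(χ_t)`, the compression of such a product by `p` vanishes unless `r = t` and `s = 1`,
and `a ↦ j_A(a) p` is a *-homomorphism on `A^δ` because `p` commutes with `j_A(A^δ)`. It is
injective because it is so in the regular covariant representation on `ℓ²(G, H)` induced from a
faithful representation of `A`; hence its image is closed and equals the corner.
-/

open scoped TensorProduct ENNReal ZeroAtInfty CStarAlgebra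

noncomputable section

namespace DiscreteCoaction

universe u v w

section ClosureOfSpan

theorem apply_mem_of_mem_closure_span {𝕜 E F : Type*} [Semiring 𝕜] [AddCommMonoid E] [Module 𝕜 E]
    [TopologicalSpace E] [AddCommMonoid F] [Module 𝕜 F] [TopologicalSpace F] {S : Set E}
    {K : Submodule 𝕜 F} (hK : IsClosed (K : Set F)) (f : E →L[𝕜] F) (h : ∀ x ∈ S, f x ∈ K) {x : E}
    (hx : x ∈ closure (Submodule.span 𝕜 S : Set E)) : f x ∈ K :=
  (hK.preimage f.continuous).closure_subset_iff.mpr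
    (Submodule.span_le.mpr h : Submodule.span 𝕜 S ≤ K.comap f.toLinearMap) hx

/-- A *-homomorphism of C*-algebras as a bounded linear map. -/
def starHomL {B D : Type*} [NonUnitalCStarAlgebra B] [NonUnitalCStarAlgebra D]
    (φ : B →⋆ₙₐ[ℂ] D) : B →L[ℂ] D where
  __ := (φ : B →ₗ[ℂ] D)
  cont := map_continuous φ

theorem starHomL_apply {B D : Type*} [NonUnitalCStarAlgebra B] [NonUnitalCStarAlgebra D]
    (φ : B →⋆ₙₐ[ℂ] D) (b : B) : starHomL φ b = φ b := rfl

theorem commute_of_dense_span {B D : Type*} [NonUnitalCStarAlgebra B] [NonUnitalCStarAlgebra D]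
    {S : Set B} (hS : Dense (Submodule.span ℂ S : Set B)) (φ : B →⋆ₙₐ[ℂ] D) (d : D)
    (h : ∀ x ∈ S, Commute (φ x) d) (x : B) : Commute (φ x) d :=
  DFunLike.congr_fun (ContinuousLinearMap.ext_on hS
    (f := ((ContinuousLinearMap.mul ℂ D).flip d).comp (starHomL φ))
    (g := (ContinuousLinearMap.mul ℂ D d).comp (starHomL φ)) h) x

theorem isClosed_range_of_injective {A D : Type*} [NonUnitalCStarAlgebra A]
    [NonUnitalCStarAlgebra D] {φ : A →⋆ₙₐ[ℂ] D} (hφ : Function.Injective φ) :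
    IsClosed (LinearMap.range (φ : A →ₗ[ℂ] D) : Set D) :=
  (NonUnitalStarAlgHom.isometry φ hφ).isClosedEmbedding.isClosed_range

theorem exists_factor_of_dense_span {A D X : Type*} [NonUnitalCStarAlgebra A]
    [NonUnitalCStarAlgebra D] [NormedAddCommGroup X] [NormedSpace ℂ X] {φ : A →⋆ₙₐ[ℂ] D}
    (hφ : Function.Injective φ) {S : Set X} (hS : Dense (Submodule.span ℂ S : Set X))
    (T : X →L[ℂ] D) (hT : ∀ x ∈ S, T x ∈ Set.range φ) : ∃ E : X →L[ℂ] A, ∀ x, φ (E x) = T x := by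
  have hrange : ∀ x, ∃ a, φ a = T x := fun x =>
    apply_mem_of_mem_closure_span (isClosed_range_of_injective hφ) T hT (hS x)
  choose E hE using hrange
  refine ⟨LinearMap.mkContinuous
    { toFun := E
      map_add' := fun x y => hφ (by simp only [map_add, hE])
      map_smul' := fun c x => hφ (by simp only [RingHom.id_apply, map_smul, hE]) }
    ‖T‖ fun x => ?_, hE⟩
  change ‖E x‖ ≤ _
  rw [← NonUnitalStarAlgHom.norm_map φ hφ, hE]
  exact T.le_opNorm x

end ClosureOfSpan

/-! ### Faithful representations -/

section PositiveFunctional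

open scoped ComplexOrder ComplexStarModule

/-- The complex-linear extension `x ↦ f(ℜ x) + i f(ℑ x)` of a real functional; unlike
`x ↦ f(x) - i f(i x)` it only depends on the values of `f` at self-adjoint elements. -/
def extendSelfAdjoint {A : Type*} [AddCommGroup A] [Module ℂ A] [StarAddMonoid A] [StarModule ℂ A]
    (f : A →ₗ[ℝ] ℝ) : A →ₗ[ℂ] ℂ where
  toFun x := f (ℜ x : A) + Complex.I * f (ℑ x : A)
  map_add' x y := by
    simp only [map_add, AddSubgroup.coe_add, Complex.ofReal_add]
    ring
  map_smul' z x := by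
    simp only [realPart_smul, imaginaryPart_smul, AddSubgroup.coe_sub, AddSubgroup.coe_add,
      selfAdjoint.val_smul, map_sub, map_add, map_smul, smul_eq_mul, RingHom.id_apply,
      Complex.ofReal_sub, Complex.ofReal_add, Complex.ofReal_mul]
    conv_rhs => rw [← Complex.re_add_im z]
    linear_combination (-(z.im : ℂ) * (f (ℑ x : A) : ℂ)) * Complex.I_sq

theorem extendSelfAdjoint_apply_of_isSelfAdjoint {A : Type*} [AddCommGroup A] [Module ℂ A]
    [StarAddMonoid A] [StarModule ℂ A] (f : A →ₗ[ℝ] ℝ) {x : A} (hx : IsSelfAdjoint x) :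
    extendSelfAdjoint f x = f x := by
  change (f (ℜ x : A) : ℂ) + Complex.I * f (ℑ x : A) = f x
  simp [hx.coe_realPart, hx.imaginaryPart]

variable {A : Type u} [NonUnitalCStarAlgebra A]

theorem exists_positiveLinearMap_apply_ne_zero [PartialOrder A] [StarOrderedRing A] {c : A}
    (hc : 0 ≤ c) (hc0 : c ≠ 0) : ∃ f : A →ₚ[ℂ] ℂ, f c ≠ 0 := by
  have hneg : -c ∉ ProperCone.positive ℝ A := fun h => by
    rw [ProperCone.mem_positive, neg_nonneg] at h
    exact hc0 (le_antisymm h hc)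
  obtain ⟨f, hf, hfc⟩ := ProperCone.hyperplane_separation_point _ hneg
  have hext : ∀ x : A, 0 ≤ x → extendSelfAdjoint f.toLinearMap x = f x := fun x hx =>
    extendSelfAdjoint_apply_of_isSelfAdjoint _ (.of_nonneg hx)
  refine ⟨PositiveLinearMap.mk₀ (extendSelfAdjoint f.toLinearMap) fun x hx => ?_, ?_⟩
  · rw [hext x hx]
    exact Complex.zero_le_real.mpr (hf x hx)
  · change extendSelfAdjoint f.toLinearMap c ≠ 0
    rw [hext c hc, Complex.ofReal_ne_zero]
    rw [map_neg] at hfc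
    linarith

theorem span_mul_eq_top : Submodule.span ℂ {x : A | ∃ b c, x = b * c} = ⊤ := by
  let _ := CStarAlgebra.spectralOrder A
  have := CStarAlgebra.spectralOrderedRing A
  refine eq_top_iff.mpr fun a _ => ?_
  obtain ⟨x, hx, -, rfl⟩ := CStarAlgebra.exists_sum_four_nonneg a
  refine Submodule.sum_mem _ fun i _ => Submodule.smul_mem _ _ (Submodule.subset_span ?_)
  obtain ⟨b, hb⟩ := CStarAlgebra.nonneg_iff_eq_star_mul_self.mp (hx i)
  exact ⟨_, _, hb⟩

variable [PartialOrder A] [StarOrderedRing A]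

theorem isNondegenerate_gns (f : A →ₚ[ℂ] ℂ) : IsNondegenerate f.gnsNonUnitalStarAlgHom := by
  set S := Submodule.span ℂ {h : f.GNS | ∃ b k, h = f.gnsNonUnitalStarAlgHom b k}
  let q : A →ₗ[ℂ] f.GNS := (UniformSpace.Completion.toComplL (𝕜 := ℂ)).toLinearMap ∘ₗ
    f.toPreGNS.toLinearMap
  have hq : ⊤ ≤ S.comap q := by
    rw [← span_mul_eq_top, Submodule.span_le]
    rintro _ ⟨b, c, rfl⟩
    exact Submodule.subset_span ⟨b, q c, by simp [q]⟩
  refine (UniformSpace.Completion.denseRange_coe (α := f.PreGNS)).mono ?_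
  rintro _ ⟨x, rfl⟩
  exact hq (x := f.ofPreGNS x) trivial

theorem exists_gns_apply_ne_zero {a : A} (ha : a ≠ 0) :
    ∃ f : A →ₚ[ℂ] ℂ, f.gnsNonUnitalStarAlgHom a ≠ 0 := by
  have hc : star (a * star a) * (a * star a) ≠ 0 := by
    rwa [Ne, CStarRing.star_mul_self_eq_zero_iff, CStarRing.mul_star_self_eq_zero_iff]
  obtain ⟨f, hf⟩ := exists_positiveLinearMap_apply_ne_zero (star_mul_self_nonneg _) hc
  refine ⟨f, fun h => hf ?_⟩
  have hvec : ‖f.leftMulMapPreGNS a (f.toPreGNS (star a))‖ = 0 := by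
    rw [← UniformSpace.Completion.norm_coe, ← f.gnsNonUnitalStarAlgHom_apply_coe, h]
    exact norm_zero
  have hnorm := f.preGNS_norm_sq (f.leftMulMapPreGNS a (f.toPreGNS (star a)))
  rw [hvec] at hnorm
  simpa using hnorm.symm

end PositiveFunctional

section HilbertSum

variable {ι : Type v} {H : ι → Type w} [∀ i, NormedAddCommGroup (H i)]
  [∀ i, InnerProductSpace ℂ (H i)]

/-- The block-diagonal operator on a Hilbert sum given by a bounded family of operators. -/
def diagonalOperator (T : ∀ i, H i →L[ℂ] H i) (C : ℝ) (hT : ∀ i, ‖T i‖ ≤ C) :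
    lp H 2 →L[ℂ] lp H 2 :=
  have hle : ∀ (ξ : lp H 2) i, ‖T i (ξ i)‖ ≤ ‖((C : ℂ) • ξ : lp H 2) i‖ := fun ξ i => by
    have hC : 0 ≤ C := (norm_nonneg _).trans (hT i)
    rw [lp.coeFn_smul, Pi.smul_apply, norm_smul, Complex.norm_real, Real.norm_of_nonneg hC]
    exact (T i).le_of_opNorm_le (hT i) _
  LinearMap.mkContinuous
    { toFun := fun ξ => ⟨fun i => T i (ξ i), (lp.memℓp ((C : ℂ) • ξ)).mono' (hle ξ)⟩
      map_add' := fun ξ η => by ext i; exact map_add (T i) (ξ i) (η i)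
      map_smul' := fun c ξ => by ext i; simp }
    ‖(C : ℂ)‖ fun ξ => by
      rw [← norm_smul]
      exact lp.norm_mono two_ne_zero (hle ξ)

theorem diagonalOperator_apply (T : ∀ i, H i →L[ℂ] H i) (C : ℝ) (hT : ∀ i, ‖T i‖ ≤ C) (ξ : lp H 2)
    (i : ι) : diagonalOperator T C hT ξ i = T i (ξ i) := rfl

theorem dense_of_single_mem [DecidableEq ι] {S : Submodule ℂ (lp H 2)}
    (h : ∀ i (k : H i), lp.single 2 i k ∈ S.topologicalClosure) : Dense (S : Set (lp H 2)) :=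
  fun ξ => S.isClosed_topologicalClosure.mem_of_tendsto (lp.hasSum_single (p := 2) (by simp) ξ)
    (Filter.Eventually.of_forall fun _ => Submodule.sum_mem _ fun i _ => h i _)

variable [∀ i, CompleteSpace (H i)] {B : Type u} [NonUnitalCStarAlgebra B]

/-- The Hilbert sum of a family of representations. -/
def directSumRep (φ : ∀ i, B →⋆ₙₐ[ℂ] (H i →L[ℂ] H i)) : B →⋆ₙₐ[ℂ] (lp H 2 →L[ℂ] lp H 2) where
  toFun b :=
    diagonalOperator (fun i => φ i b) ‖b‖ fun i => NonUnitalStarAlgHom.norm_apply_le (φ i) b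
  map_smul' c b := by ext ξ i; simp [diagonalOperator_apply]
  map_zero' := by ext ξ i; simp [diagonalOperator_apply]
  map_add' b c := by ext ξ i; simp [diagonalOperator_apply]
  map_mul' b c := by ext ξ i; simp [diagonalOperator_apply]
  map_star' b := by
    rw [ContinuousLinearMap.star_eq_adjoint, ContinuousLinearMap.eq_adjoint_iff]
    intro ξ η
    rw [lp.inner_eq_tsum, lp.inner_eq_tsum]
    refine tsum_congr fun i => ?_
    rw [diagonalOperator_apply, diagonalOperator_apply, map_star,
      ContinuousLinearMap.star_eq_adjoint, ContinuousLinearMap.adjoint_inner_left]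

variable (φ : ∀ i, B →⋆ₙₐ[ℂ] (H i →L[ℂ] H i))

theorem directSumRep_apply (b : B) (ξ : lp H 2) (i : ι) : directSumRep φ b ξ i = φ i b (ξ i) := rfl

theorem directSumRep_single [DecidableEq ι] (b : B) (i : ι) (h : H i) :
    directSumRep φ b (lp.single 2 i h) = lp.single 2 i (φ i b h) := by
  ext j
  rw [directSumRep_apply, lp.single_apply, lp.single_apply]
  obtain rfl | hj := eq_or_ne j i
  · simp
  · simp [hj]

theorem injective_directSumRep (h : ∀ b, b ≠ 0 → ∃ i, φ i b ≠ 0) :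
    Function.Injective (directSumRep φ) := by
  classical
  refine (injective_iff_map_eq_zero _).mpr fun b hb => ?_
  by_contra hb0
  obtain ⟨i, hi⟩ := h b hb0
  refine hi (ContinuousLinearMap.ext fun k => ?_)
  have hsingle : lp.single (E := H) 2 i (φ i b k) = 0 := by rw [← directSumRep_single, hb]; rfl
  simpa using congrArg (fun ξ : lp H 2 => ξ i) hsingle

theorem isNondegenerate_directSumRep (h : ∀ i, IsNondegenerate (φ i)) :
    IsNondegenerate (directSumRep φ) := by
  classical
  refine dense_of_single_mem fun i k => ?_
  refine apply_mem_of_mem_closure_span (Submodule.isClosed_topologicalClosure _)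
    (lp.singleContinuousLinearMap ℂ H 2 i) ?_ (h i k)
  rintro _ ⟨b, k, rfl⟩
  exact Submodule.le_topologicalClosure _
    (Submodule.subset_span ⟨b, lp.single 2 i k, (directSumRep_single φ b i k).symm⟩)

end HilbertSum

theorem exists_faithful_rep (A : Type u) [NonUnitalCStarAlgebra A] :
    ∃ (H : Type u) (_ : NormedAddCommGroup H) (_ : InnerProductSpace ℂ H) (_ : CompleteSpace H)
      (π : A →⋆ₙₐ[ℂ] (H →L[ℂ] H)), Function.Injective π ∧ IsNondegenerate π := by
  let _ := CStarAlgebra.spectralOrder A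
  have := CStarAlgebra.spectralOrderedRing A
  choose f hf using fun a : {a : A // a ≠ 0} => exists_gns_apply_ne_zero a.2
  exact ⟨lp (fun a => (f a).GNS) 2, inferInstance, inferInstance, inferInstance,
    directSumRep fun a => (f a).gnsNonUnitalStarAlgHom,
    injective_directSumRep _ fun b hb => ⟨⟨b, hb⟩, hf ⟨b, hb⟩⟩,
    isNondegenerate_directSumRep _ fun a => isNondegenerate_gns (f a)⟩

/-! ### Elementary tensors -/

section ElementaryTensors

variable {G : Type v} [Group G] {A : Type u} {B : Type w} [NonUnitalCStarAlgebra A]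
  [NonUnitalCStarAlgebra B]

theorem dense_span_groupU :
    Dense (Submodule.span ℂ (Set.range (groupU (G := G))) : Set (GroupCStar G)) := by
  have hrange : LinearMap.range (groupNorm G).toCompl ≤
      Submodule.span ℂ (Set.range (groupU (G := G))) := by
    rintro _ ⟨x, rfl⟩
    induction x using MonoidAlgebra.induction_linear with
    | zero => exact map_zero (groupNorm G).toCompl ▸ Submodule.zero_mem _
    | add x y hx hy => exact map_add (groupNorm G).toCompl x y ▸ Submodule.add_mem _ hx hy
    | single s c =>
      rw [← mul_one c, ← MonoidAlgebra.smul_single', map_smul]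
      exact Submodule.smul_mem _ c (Submodule.subset_span ⟨s, rfl⟩)
  exact (groupNorm G).denseRange_toCompl.mono hrange

namespace MaxTensor

/-- The elementary tensor as a bounded bilinear map. -/
def tmulL : A →L[ℂ] B →L[ℂ] MaxTensor A B :=
  tmulₗ.mkContinuous₂ 1 fun a b => by
    rw [one_mul]
    exact norm_tmul_le a b

/-- The bounded linear map `a ↦ a ⊗ b`. -/
def tmulRightL (A : Type u) [NonUnitalCStarAlgebra A] (b : B) : A →L[ℂ] MaxTensor A B :=
  tmulL.flip b

theorem tmulRightL_apply (a : A) (b : B) : tmulRightL A b a = tmul a b := rfl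

theorem zero_tmul (b : B) : tmul (0 : A) b = 0 := LinearMap.map_zero₂ tmulₗ b

theorem dense_span_tmul :
    Dense (Submodule.span ℂ (Set.image2 tmul (Set.univ : Set A) (Set.univ : Set B)) :
      Set (MaxTensor A B)) := by
  have hrange : LinearMap.range (ofAlg (A := A) (B := B)) ≤
      Submodule.span ℂ (Set.image2 tmul Set.univ Set.univ) := by
    rw [LinearMap.range_eq_map, ← TensorProduct.span_tmul_eq_top, Submodule.map_span,
      Submodule.span_le]
    rintro _ ⟨_, ⟨a, b, rfl⟩, rfl⟩
    exact Submodule.subset_span ⟨a, trivial, b, trivial, rfl⟩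
  exact (maxNorm A B).denseRange_toCompl.mono hrange

theorem dense_span_image2_tmul {S : Set A} {T : Set B} (hS : Dense (Submodule.span ℂ S : Set A))
    (hT : Dense (Submodule.span ℂ T : Set B)) :
    Dense (Submodule.span ℂ (Set.image2 tmul S T) : Set (MaxTensor A B)) := by
  set K := (Submodule.span ℂ (Set.image2 tmul S T)).topologicalClosure
  have hK : IsClosed (K : Set (MaxTensor A B)) := Submodule.isClosed_topologicalClosure _
  have hright : ∀ a ∈ S, ∀ b, tmul a b ∈ K := fun a ha b =>
    apply_mem_of_mem_closure_span hK (tmulL a)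
      (fun b hb => Submodule.le_topologicalClosure _ (Submodule.subset_span ⟨a, ha, b, hb, rfl⟩))
      (hT b)
  have hall : ∀ a b, tmul a b ∈ K := fun a b =>
    apply_mem_of_mem_closure_span hK (tmulRightL A b) (fun a ha => hright a ha b) (hS a)
  refine fun y => apply_mem_of_mem_closure_span hK (.id ℂ _) ?_ (dense_span_tmul y)
  rintro _ ⟨a, -, b, -, rfl⟩
  exact hall a b

theorem dense_span_tmul_groupU :
    Dense (Submodule.span ℂ (Set.image2 tmul (Set.univ : Set A) (Set.range (groupU (G := G)))) :
      Set (MaxTensor A (GroupCStar G))) :=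
  dense_span_image2_tmul (by simp) dense_span_groupU

theorem ext_tmul_groupU {E : Type*} [NormedAddCommGroup E] [NormedSpace ℂ E]
    {f g : MaxTensor A (GroupCStar G) →L[ℂ] E}
    (h : ∀ a s, f (tmul a (groupU s)) = g (tmul a (groupU s))) : f = g := by
  refine ContinuousLinearMap.ext_on dense_span_tmul_groupU ?_
  rintro _ ⟨a, -, _, ⟨s, rfl⟩, rfl⟩
  exact h a s

variable {D : Type*} [NonUnitalCStarAlgebra D]

/-- The *-homomorphism `a ⊗ b ↦ φ(a) ψ(b)` given by two *-homomorphisms with commuting ranges. -/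
def commLift (φ : A →⋆ₙₐ[ℂ] D) (ψ : B →⋆ₙₐ[ℂ] D) (h : ∀ a b, Commute (φ a) (ψ b)) :
    MaxTensor A B →⋆ₙₐ[ℂ] D :=
  lift ((LinearMap.mul ℂ D).compl₁₂ (φ : A →ₗ[ℂ] D) (ψ : B →ₗ[ℂ] D))
    (fun a a' b b' => by
      change φ a * ψ b * (φ a' * ψ b') = φ (a * a') * ψ (b * b')
      rw [map_mul, map_mul, (h a' b).symm.mul_mul_mul_comm])
    (fun a b => by
      change star (φ a * ψ b) = φ (star a) * ψ (star b)
      rw [star_mul, ← map_star, ← map_star, (h _ _).eq])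
    (fun a b => (norm_mul_le (φ a) (ψ b)).trans (mul_le_mul
      (NonUnitalStarAlgHom.norm_apply_le φ a) (NonUnitalStarAlgHom.norm_apply_le ψ b)
      (norm_nonneg _) (norm_nonneg _)))

theorem commLift_tmul (φ : A →⋆ₙₐ[ℂ] D) (ψ : B →⋆ₙₐ[ℂ] D) (h : ∀ a b, Commute (φ a) (ψ b))
    (a : A) (b : B) : commLift φ ψ h (tmul a b) = φ a * ψ b :=
  lift_tmul _ _ _ _ a b

end MaxTensor

end ElementaryTensors

/-! ### Regular representations on `ℓ²(G, H)` -/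

section Translation

variable {ι : Type v} {H : Type w} [NormedAddCommGroup H] [InnerProductSpace ℂ H]

/-- The operator on `ℓ²(ι, H)` that permutes the coordinates. -/
def permOp (H : Type w) [NormedAddCommGroup H] [InnerProductSpace ℂ H] (e : Equiv.Perm ι) :
    lp (fun _ : ι => H) 2 →L[ℂ] lp (fun _ : ι => H) 2 :=
  have h2 : 0 < (2 : ℝ≥0∞).toReal := by simp
  LinearMap.mkContinuous
    { toFun := fun ξ => ⟨fun i => ξ (e.symm i), memℓp_gen
        ((e.symm.summable_iff (f := fun i => ‖ξ i‖ ^ (2 : ℝ≥0∞).toReal)).mpr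
          ((lp.memℓp ξ).summable h2))⟩
      map_add' := fun ξ η => by ext i; rfl
      map_smul' := fun c ξ => by ext i; rfl }
    1 fun ξ => by
      rw [one_mul]
      refine lp.norm_le_of_tsum_le h2 (norm_nonneg _) ?_
      rw [lp.norm_rpow_eq_tsum h2]
      exact (e.symm.tsum_eq (fun i => ‖ξ i‖ ^ (2 : ℝ≥0∞).toReal)).le

theorem permOp_apply (e : Equiv.Perm ι) (ξ : lp (fun _ : ι => H) 2) (i : ι) :
    permOp H e ξ i = ξ (e.symm i) := rfl

theorem permOp_single [DecidableEq ι] (e : Equiv.Perm ι) (i : ι) (h : H) :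
    permOp H e (lp.single (E := fun _ : ι => H) 2 i h) = lp.single 2 (e i) h := by
  ext j
  rw [permOp_apply, lp.single_apply, lp.single_apply]
  simp only [Pi.single_apply, Equiv.symm_apply_eq]

theorem commute_permOp {e f : Equiv.Perm ι} (h : Commute e f) :
    Commute (permOp H e) (permOp H f) := by
  ext ξ i
  exact congrArg (fun g : Equiv.Perm ι => ξ (g.symm i)) h.eq

/-- The matrix coefficient `T ↦ T_{i,j}` of operators on `ℓ²(ι, H)`. -/
def matrixCoeff (H : Type w) [NormedAddCommGroup H] [InnerProductSpace ℂ H] [DecidableEq ι]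
    (i j : ι) : (lp (fun _ : ι => H) 2 →L[ℂ] lp (fun _ : ι => H) 2) →L[ℂ] (H →L[ℂ] H) :=
  (ContinuousLinearMap.compL ℂ H (lp (fun _ : ι => H) 2) H
      (lp.evalCLM ℂ (fun _ : ι => H) 2 i)).comp
    ((ContinuousLinearMap.compL ℂ H (lp (fun _ : ι => H) 2) (lp (fun _ : ι => H) 2)).flip
      (lp.singleContinuousLinearMap ℂ (fun _ : ι => H) 2 j))

theorem matrixCoeff_apply [DecidableEq ι] (i j : ι)
    (T : lp (fun _ : ι => H) 2 →L[ℂ] lp (fun _ : ι => H) 2) (h : H) :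
    matrixCoeff H i j T h = T (lp.single (E := fun _ : ι => H) 2 j h) i := rfl

variable [CompleteSpace H]

section PermRep

variable {G : Type u} [Group G] (H)

theorem star_permOp (e : Equiv.Perm ι) : star (permOp H e) = permOp H e⁻¹ := by
  rw [ContinuousLinearMap.star_eq_adjoint, eq_comm, ContinuousLinearMap.eq_adjoint_iff]
  intro ξ η
  rw [lp.inner_eq_tsum, lp.inner_eq_tsum, ← e.symm.tsum_eq]
  refine tsum_congr fun i => ?_
  rw [permOp_apply, permOp_apply]
  exact congrArg (fun j => inner ℂ (ξ j) (η (e.symm i))) (e.apply_symm_apply i)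

/-- The representation of `C*(G)` on `ℓ²(ι, H)` given by an action of `G` on `ι`. -/
def permRep (θ : G →* Equiv.Perm ι) :
    GroupCStar G →⋆ₙₐ[ℂ] (lp (fun _ : ι => H) 2 →L[ℂ] lp (fun _ : ι => H) 2) :=
  groupLift
    { toFun := fun s => permOp H (θ s)
      map_mul' := fun s t => by
        rw [map_mul]
        rfl }
    fun s => by
      change permOp H (θ s⁻¹) = star (permOp H (θ s))
      rw [star_permOp, map_inv]

theorem permRep_groupU (θ : G →* Equiv.Perm ι) (s : G) :
    permRep H θ (groupU s) = permOp H (θ s) := groupLift_groupU _ _ s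

end PermRep

/-- The amplification of a representation on `H` to `ℓ²(ι, H)`. -/
def amplify {A : Type u} [NonUnitalCStarAlgebra A] (ι : Type v) (π : A →⋆ₙₐ[ℂ] (H →L[ℂ] H)) :
    A →⋆ₙₐ[ℂ] (lp (fun _ : ι => H) 2 →L[ℂ] lp (fun _ : ι => H) 2) :=
  directSumRep fun _ : ι => π

theorem commute_amplify_permOp {A : Type u} [NonUnitalCStarAlgebra A]
    (π : A →⋆ₙₐ[ℂ] (H →L[ℂ] H)) (a : A) (e : Equiv.Perm ι) :
    Commute (amplify ι π a) (permOp H e) := rfl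

theorem commute_permRep {G : Type u} [Group G] {θ : G →* Equiv.Perm ι}
    {T : lp (fun _ : ι => H) 2 →L[ℂ] lp (fun _ : ι => H) 2}
    (h : ∀ s, Commute T (permOp H (θ s))) (x : GroupCStar G) : Commute T (permRep H θ x) :=
  (commute_of_dense_span dense_span_groupU _ T (Set.forall_mem_range.mpr fun s => by
    rw [permRep_groupU]
    exact (h s).symm) x).symm

/-- Right translation, as a left action. -/
def rightPerm (G : Type v) [Group G] : G →* Equiv.Perm G where
  toFun s := Equiv.mulRight s⁻¹
  map_one' := by ext; simp
  map_mul' s t := by ext; simp [mul_assoc]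

theorem commute_toPermHom_rightPerm {G : Type v} [Group G] (s t : G) :
    Commute (MulAction.toPermHom G G s) (rightPerm G t) :=
  Equiv.ext fun r => (mul_assoc s r t⁻¹).symm

variable {G : Type v} [Group G] {A : Type u} [NonUnitalCStarAlgebra A]
  (π : A →⋆ₙₐ[ℂ] (H →L[ℂ] H))

/-- The representation `π ⊗ λ` of `A ⊗ C*(G)` on `ℓ²(G, H)`. -/
def regularRep : MaxTensor A (GroupCStar G) →⋆ₙₐ[ℂ]
    (lp (fun _ : G => H) 2 →L[ℂ] lp (fun _ : G => H) 2) :=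
  MaxTensor.commLift (amplify G π) (permRep H (MulAction.toPermHom G G)) fun a =>
    commute_permRep fun _ => commute_amplify_permOp π a _

theorem regularRep_tmul (a : A) (s : G) : regularRep π (MaxTensor.tmul a (groupU s)) =
    amplify G π a * permOp H (MulAction.toPermHom G G s) := by
  rw [regularRep, MaxTensor.commLift_tmul, permRep_groupU]

theorem regularRep_tmul_single [DecidableEq G] (a : A) (s t : G) (h : H) :
    regularRep π (MaxTensor.tmul a (groupU s)) (lp.single (E := fun _ : G => H) 2 t h) =
      lp.single 2 (s * t) (π a h) := by
  rw [regularRep_tmul, mul_apply_eq_comp, permOp_single, amplify, directSumRep_single]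
  rfl

theorem commute_regularRep (y : MaxTensor A (GroupCStar G)) (t : G) :
    Commute (regularRep π y) (permOp H (rightPerm G t)) := by
  refine commute_of_dense_span MaxTensor.dense_span_tmul_groupU _ _ ?_ y
  rintro _ ⟨a, -, _, ⟨s, rfl⟩, rfl⟩
  rw [regularRep_tmul]
  exact (commute_amplify_permOp π a _).mul_left (commute_permOp (commute_toPermHom_rightPerm s t))

/-- The representation of `(A ⊗ C*(G)) ⊗ C*(G)` on `ℓ²(G, H)` given by `π` and the left and right
regular representations. -/
def biregularRep : MaxTensor (MaxTensor A (GroupCStar G)) (GroupCStar G) →⋆ₙₐ[ℂ]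
    (lp (fun _ : G => H) 2 →L[ℂ] lp (fun _ : G => H) 2) :=
  MaxTensor.commLift (regularRep π) (permRep H (rightPerm G)) fun y =>
    commute_permRep fun t => commute_regularRep π y t

theorem biregularRep_tmul_single [DecidableEq G] (a : A) (s t r : G) (h : H) :
    biregularRep π (MaxTensor.tmul (MaxTensor.tmul a (groupU s)) (groupU t))
      (lp.single (E := fun _ : G => H) 2 r h) = lp.single 2 (s * (r * t⁻¹)) (π a h) := by
  rw [biregularRep, MaxTensor.commLift_tmul, permRep_groupU, mul_apply_eq_comp,
    permOp_single, regularRep_tmul_single]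
  rfl

end Translation

/-! ### Slice maps -/

section Slice

variable {G : Type v} [Group G] {A : Type u} [NonUnitalCStarAlgebra A]

/-- The trivial representation of `G` as a character of `C*(G)`. -/
def counit (G : Type v) [Group G] : GroupCStar G →⋆ₙₐ[ℂ] ℂ :=
  groupLift
    { toFun := fun _ => 1
      map_mul' := fun _ _ => (mul_one 1).symm } fun _ => (star_one ℂ).symm

theorem counit_groupU (s : G) : counit G (groupU s) = 1 := groupLift_groupU _ _ s

/-- The slice map `a ⊗ b ↦ τ(b) a` given by a character `τ`. -/
def charSlice (A : Type u) [NonUnitalCStarAlgebra A] {B : Type w} [NonUnitalCStarAlgebra B]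
    (τ : B →⋆ₙₐ[ℂ] ℂ) : MaxTensor A B →⋆ₙₐ[ℂ] A :=
  MaxTensor.lift ((LinearMap.lsmul ℂ A).flip.compl₂ (τ : B →ₗ[ℂ] ℂ))
    (fun a a' b b' => by
      change τ b • a * τ b' • a' = τ (b * b') • (a * a')
      rw [map_mul, smul_mul_smul_comm])
    (fun a b => by
      change star (τ b • a) = τ (star b) • star a
      rw [star_smul, map_star])
    (fun a b => by
      change ‖τ b • a‖ ≤ ‖a‖ * ‖b‖
      rw [norm_smul, mul_comm]
      exact mul_le_mul_of_nonneg_left (NonUnitalStarAlgHom.norm_apply_le τ b) (norm_nonneg a))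

theorem charSlice_counit_tmul (a : A) (s : G) :
    charSlice A (counit G) (MaxTensor.tmul a (groupU s)) = a := by
  refine (MaxTensor.lift_tmul _ _ _ _ _ _).trans ?_
  change counit G (groupU s) • a = a
  rw [counit_groupU, one_smul]

theorem exists_slice [DecidableEq G] (A : Type u) [NonUnitalCStarAlgebra A] (s : G) :
    ∃ E : MaxTensor A (GroupCStar G) →L[ℂ] A,
      ∀ a t, E (MaxTensor.tmul a (groupU t)) = if t = s then a else 0 := by
  obtain ⟨H, _, _, _, π, hπ, -⟩ := exists_faithful_rep A
  have hcoeff : ∀ a t, matrixCoeff H s 1 (regularRep π (MaxTensor.tmul a (groupU t))) =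
      π (if t = s then a else 0) := fun a t => by
    ext h
    rw [matrixCoeff_apply, regularRep_tmul_single, mul_one, lp.single_apply, Pi.single_apply,
      if_congr eq_comm rfl rfl]
    split_ifs <;> simp
  obtain ⟨E, hE⟩ := exists_factor_of_dense_span hπ MaxTensor.dense_span_tmul_groupU
    ((matrixCoeff H s 1).comp (starHomL (regularRep π))) (by
      rintro _ ⟨a, -, _, ⟨t, rfl⟩, rfl⟩
      exact ⟨_, (hcoeff a t).symm⟩)
  exact ⟨E, fun a t => hπ ((hE _).trans (hcoeff a t))⟩

theorem exists_diagonalSlice [DecidableEq G] (A : Type u) [NonUnitalCStarAlgebra A] :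
    ∃ E : MaxTensor (MaxTensor A (GroupCStar G)) (GroupCStar G) →L[ℂ] A, ∀ a s t,
      E (MaxTensor.tmul (MaxTensor.tmul a (groupU s)) (groupU t)) = if s = t then a else 0 := by
  obtain ⟨H, _, _, _, π, hπ, -⟩ := exists_faithful_rep A
  have hcoeff : ∀ a (s t : G), matrixCoeff H 1 1 (biregularRep π
      (MaxTensor.tmul (MaxTensor.tmul a (groupU s)) (groupU t))) =
      π (if s = t then a else 0) := fun a s t => by
    ext h
    rw [matrixCoeff_apply, biregularRep_tmul_single, one_mul, lp.single_apply, Pi.single_apply,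
      if_congr (eq_comm.trans mul_inv_eq_one) rfl rfl]
    split_ifs <;> simp
  obtain ⟨E, hE⟩ := exists_factor_of_dense_span hπ
    (MaxTensor.dense_span_image2_tmul MaxTensor.dense_span_tmul_groupU
      (dense_span_groupU (G := G)))
    ((matrixCoeff H 1 1).comp (starHomL (biregularRep π))) (by
      rintro _ ⟨_, ⟨a, -, _, ⟨s, rfl⟩, rfl⟩, _, ⟨t, rfl⟩, rfl⟩
      exact ⟨_, (hcoeff a s t).symm⟩)
  exact ⟨E, fun a s t => hπ ((hE _).trans (hcoeff a s t))⟩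

open Classical in
/-- The slice map `A ⊗ C*(G) → A` given by the coefficient functional of `C*(G)` at `s`. -/
def slice (s : G) : MaxTensor A (GroupCStar G) →L[ℂ] A := (exists_slice A s).choose

open Classical in
/-- The slice map `(A ⊗ C*(G)) ⊗ C*(G) → A` given by the functional `s ⊗ t ↦ δ_{s,t}`. -/
def diagonalSlice : MaxTensor (MaxTensor A (GroupCStar G)) (GroupCStar G) →L[ℂ] A :=
  (exists_diagonalSlice A).choose

theorem slice_tmul [DecidableEq G] (s t : G) (a : A) :
    slice s (MaxTensor.tmul a (groupU t)) = if t = s then a else 0 := by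
  unfold slice
  convert (exists_slice A s).choose_spec a t

theorem diagonalSlice_tmul_tmul [DecidableEq G] (s t : G) (a : A) :
    diagonalSlice (MaxTensor.tmul (MaxTensor.tmul a (groupU s)) (groupU t)) =
      if s = t then a else 0 := by
  unfold diagonalSlice
  convert (exists_diagonalSlice A).choose_spec a s t

end Slice

/-! ### The inverse of the associator -/

namespace MaxTensor

section AssocInv

variable {A : Type u} {B : Type v} {C : Type w} [NonUnitalCStarAlgebra A]
  [NonUnitalCStarAlgebra B] [NonUnitalCStarAlgebra C]

/-- The linear map sending `b ⊗ c` to the bounded operator `a ↦ (a ⊗ b) ⊗ c`. -/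
def rightLegₗ (A : Type u) {B : Type v} {C : Type w} [NonUnitalCStarAlgebra A]
    [NonUnitalCStarAlgebra B] [NonUnitalCStarAlgebra C] :
    B ⊗[ℂ] C →ₗ[ℂ] A →L[ℂ] MaxTensor (MaxTensor A B) C :=
  TensorProduct.lift <| LinearMap.mk₂ ℂ
    (fun b c => (tmulRightL (MaxTensor A B) c).comp (tmulRightL A b))
    (fun b b' c => by ext a; simp [tmulRightL])
    (fun z b c => by ext a; simp [tmulRightL])
    (fun b c c' => by ext a; simp [tmulRightL])
    (fun z b c => by ext a; simp [tmulRightL])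

theorem rightLegₗ_tmul (a : A) (b : B) (c : C) :
    rightLegₗ A (b ⊗ₜ[ℂ] c) a = tmul (tmul a b) c := rfl

theorem rightLegₗ_mul (a a' : A) (x y : B ⊗[ℂ] C) :
    rightLegₗ A x a * rightLegₗ A y a' = rightLegₗ A (x * y) (a * a') := by
  induction x using TensorProduct.induction_on with
  | zero => simp
  | add x₁ x₂ h₁ h₂ =>
    simp only [add_mul, map_add, add_apply, h₁, h₂]
  | tmul b c =>
    induction y using TensorProduct.induction_on with
    | zero => simp
    | add y₁ y₂ h₁ h₂ =>
      simp only [mul_add, map_add, add_apply, h₁, h₂]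
    | tmul b' c' =>
      simp only [Algebra.TensorProduct.tmul_mul_tmul, rightLegₗ_tmul, tmul_mul]

theorem star_rightLegₗ (a : A) (x : B ⊗[ℂ] C) :
    star (rightLegₗ A x a) = rightLegₗ A (star x) (star a) := by
  induction x using TensorProduct.induction_on with
  | zero => simp
  | add x y hx hy => simp only [star_add, map_add, add_apply, hx, hy]
  | tmul b c => simp only [TensorProduct.star_tmul, rightLegₗ_tmul, star_tmul]

theorem norm_rightLegₗ_star_le (x : B ⊗[ℂ] C) :
    ‖rightLegₗ A (star x)‖ ≤ ‖rightLegₗ A x‖ := by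
  refine ContinuousLinearMap.opNorm_le_bound _ (norm_nonneg _) fun a => ?_
  rw [← star_star a, ← star_rightLegₗ, norm_star, norm_star]
  exact (rightLegₗ A x).le_opNorm _

theorem norm_rightLegₗ_mul_le (x y : B ⊗[ℂ] C) :
    ‖rightLegₗ A (x * y)‖ ≤ ‖rightLegₗ A x‖ * ‖rightLegₗ A y‖ := by
  let _ := CStarAlgebra.spectralOrder A
  have := CStarAlgebra.spectralOrderedRing A
  -- For an approximate unit `u`, `rightLegₗ (x * y) (a * u) = rightLegₗ x a * rightLegₗ y u`.
  have hu := CStarAlgebra.increasingApproximateUnit A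
  refine ContinuousLinearMap.opNorm_le_bound _ (by positivity) fun a => ?_
  have hlim : Filter.Tendsto (fun u => ‖rightLegₗ A (x * y) (a * u)‖)
      (CStarAlgebra.approximateUnit A) (nhds ‖rightLegₗ A (x * y) a‖) :=
    (((rightLegₗ A (x * y)).continuous.tendsto _).comp (hu.tendsto_mul_left a)).norm
  refine le_of_tendsto hlim ?_
  filter_upwards [hu.eventually_norm] with u hu1
  rw [← rightLegₗ_mul]
  calc ‖rightLegₗ A x a * rightLegₗ A y u‖ ≤ (‖rightLegₗ A x‖ * ‖a‖) * (‖rightLegₗ A y‖ * 1) :=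
        (norm_mul_le _ _).trans (mul_le_mul ((rightLegₗ A x).le_opNorm a)
          ((rightLegₗ A y).le_opNorm_of_le hu1) (norm_nonneg _) (by positivity))
    _ = _ := by ring

/-- The C*-seminorm on `B ⊙ C` given by the norms of the operators `a ↦ (a ⊗ b) ⊗ c`. -/
def rightLegSeminorm (A : Type u) (B : Type v) (C : Type w) [NonUnitalCStarAlgebra A]
    [NonUnitalCStarAlgebra B] [NonUnitalCStarAlgebra C] : CStarSeminorm (B ⊗[ℂ] C) where
  toSeminorm := (normSeminorm ℂ (A →L[ℂ] MaxTensor (MaxTensor A B) C)).comp (rightLegₗ A)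
  mul_le x y := norm_rightLegₗ_mul_le x y
  star_mul_self x := by
    change ‖rightLegₗ A (star x * x)‖ = ‖rightLegₗ A x‖ * ‖rightLegₗ A x‖
    refine le_antisymm ((norm_rightLegₗ_mul_le _ _).trans
      (mul_le_mul_of_nonneg_right (norm_rightLegₗ_star_le x) (norm_nonneg _))) ?_
    have h : ‖rightLegₗ A x‖ ≤ √‖rightLegₗ A (star x * x)‖ := by
      refine ContinuousLinearMap.opNorm_le_bound _ (Real.sqrt_nonneg _) fun a => ?_
      rw [← Real.sqrt_sq (norm_nonneg a), ← Real.sqrt_mul (norm_nonneg _)]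
      refine Real.le_sqrt_of_sq_le ?_
      rw [sq, ← CStarRing.norm_star_mul_self, star_rightLegₗ, rightLegₗ_mul, sq,
        ← CStarRing.norm_star_mul_self]
      exact (rightLegₗ A (star x * x)).le_opNorm _
    calc _ ≤ √‖rightLegₗ A (star x * x)‖ * √‖rightLegₗ A (star x * x)‖ :=
          mul_le_mul h h (norm_nonneg _) (Real.sqrt_nonneg _)
      _ = _ := Real.mul_self_sqrt (norm_nonneg _)

theorem norm_rightLegₗ_le (x : B ⊗[ℂ] C) : ‖rightLegₗ A x‖ ≤ maxNorm B C x := by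
  refine CStarSeminorm.le_sup (S := crossSeminorms B C) (p := rightLegSeminorm A B C) _ _
    (fun b c => ?_) x
  refine ContinuousLinearMap.opNorm_le_bound _ (by positivity) fun a => ?_
  rw [rightLegₗ_tmul]
  calc ‖tmul (tmul a b) c‖ ≤ (‖a‖ * ‖b‖) * ‖c‖ := (norm_tmul_le _ _).trans
        (mul_le_mul_of_nonneg_right (norm_tmul_le a b) (norm_nonneg c))
    _ = _ := by ring

/-- The bounded extension of `rightLegₗ` to the maximal tensor product. -/
def rightLeg : MaxTensor B C →L[ℂ] A →L[ℂ] MaxTensor (MaxTensor A B) C :=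
  (maxNorm B C).extendL (rightLegₗ A) 1 (fun x => by
    rw [one_mul]
    exact norm_rightLegₗ_le x)

theorem rightLeg_ofAlg (x : B ⊗[ℂ] C) : rightLeg (ofAlg x) = rightLegₗ A x :=
  (maxNorm B C).extendL_toCompl _ _ _ x

theorem norm_rightLeg_apply_le (a : A) (x : MaxTensor B C) : ‖rightLeg x a‖ ≤ ‖a‖ * ‖x‖ := by
  have h : ‖(rightLeg x : A →L[ℂ] MaxTensor (MaxTensor A B) C)‖ ≤ 1 * ‖x‖ :=
    (maxNorm B C).norm_extendL_le (rightLegₗ A) 1 _ x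
  rw [one_mul] at h
  rw [mul_comm]
  exact ContinuousLinearMap.le_of_opNorm_le _ h a

theorem rightLeg_mul (a a' : A) (x y : MaxTensor B C) :
    rightLeg x a * rightLeg y a' = rightLeg (x * y) (a * a') := by
  refine induction_on x (isClosed_eq (by fun_prop) (by fun_prop)) fun x => ?_
  refine induction_on y (isClosed_eq (by fun_prop) (by fun_prop)) fun y => ?_
  rw [← ofAlg_mul, rightLeg_ofAlg, rightLeg_ofAlg, rightLeg_ofAlg, rightLegₗ_mul]

theorem star_rightLeg (a : A) (x : MaxTensor B C) :
    star (rightLeg x a) = rightLeg (star x) (star a) := by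
  refine induction_on x (isClosed_eq (by fun_prop) (by fun_prop)) fun x => ?_
  rw [← ofAlg_star, rightLeg_ofAlg, rightLeg_ofAlg, star_rightLegₗ]

/-- The canonical *-homomorphism `A ⊗ (B ⊗ C) → (A ⊗ B) ⊗ C`. -/
def assocInv : MaxTensor A (MaxTensor B C) →⋆ₙₐ[ℂ] MaxTensor (MaxTensor A B) C :=
  lift (LinearMap.mk₂ ℂ (fun a x => rightLeg x a) (fun a a' x => map_add (rightLeg x) a a')
      (fun z a x => map_smul (rightLeg x) z a)
      (fun a x y => by rw [map_add, add_apply])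
      (fun z a x => by rw [map_smul, smul_apply]))
    (fun a a' x y => rightLeg_mul a a' x y) (fun a x => star_rightLeg a x)
    (fun a x => norm_rightLeg_apply_le a x)

theorem assocInv_tmul (a : A) (b : B) (c : C) :
    assocInv (tmul a (tmul b c)) = tmul (tmul a b) c := by
  refine (lift_tmul _ _ _ _ _ _).trans ?_
  change rightLeg (ofAlg (b ⊗ₜ[ℂ] c)) a = _
  rw [rightLeg_ofAlg, rightLegₗ_tmul]

theorem assocInv_assoc {C : Type w} [CStarAlgebra C] (z : MaxTensor (MaxTensor A B) C) :
    assocInv (assoc z) = z := by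
  have hdense := dense_span_image2_tmul (dense_span_tmul (A := A) (B := B))
    (T := (Set.univ : Set C)) (by simp)
  refine DFunLike.congr_fun (ContinuousLinearMap.ext_on hdense
    (f := (starHomL assocInv).comp (starHomL assoc)) (g := .id ℂ _) ?_) z
  rintro _ ⟨_, ⟨a, -, b, -, rfl⟩, c, -, rfl⟩
  exact (congrArg assocInv (assoc_tmul a b c)).trans (assocInv_tmul a b c)

end AssocInv

/-- The *-homomorphism `A ⊗ C*(G) → (A ⊗ C*(G)) ⊗ C*(G)`, `a ⊗ s ↦ (a ⊗ s) ⊗ s`. -/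
def diagonal (G : Type v) [Group G] (A : Type u) [NonUnitalCStarAlgebra A] :
    MaxTensor A (GroupCStar G) →⋆ₙₐ[ℂ] MaxTensor (MaxTensor A (GroupCStar G)) (GroupCStar G) :=
  assocInv.comp (map (NonUnitalStarAlgHom.id ℂ A) (comult G))

theorem diagonal_tmul {G : Type v} [Group G] {A : Type u} [NonUnitalCStarAlgebra A] (a : A)
    (s : G) : diagonal G A (tmul a (groupU s)) = tmul (tmul a (groupU s)) (groupU s) := by
  change assocInv (map _ _ _) = _
  rw [map_tmul, comult_groupU, assocInv_tmul]
  rfl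

end MaxTensor

/-! ### Spectral subspaces -/

namespace Coaction

variable {G : Type v} [Group G] {A : Type u} [NonUnitalCStarAlgebra A] (δ : Coaction G A)

theorem mem_spectralSubspace {s : G} {a : A} :
    a ∈ δ.spectralSubspace s ↔ δ.toHom a = MaxTensor.tmul a (groupU s) := Iff.rfl

theorem isClosed_spectralSubspace (s : G) : IsClosed (δ.spectralSubspace s : Set A) :=
  isClosed_eq (map_continuous δ.toHom)
    (MaxTensor.tmulRightL A (groupU s)).continuous

theorem mul_mem_spectralSubspace {s t : G} {a b : A} (ha : a ∈ δ.spectralSubspace s)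
    (hb : b ∈ δ.spectralSubspace t) : a * b ∈ δ.spectralSubspace (s * t) := by
  rw [mem_spectralSubspace] at *
  rw [map_mul, ha, hb, MaxTensor.tmul_mul, groupU_mul]

theorem star_mem_spectralSubspace {s : G} {a : A} (ha : a ∈ δ.spectralSubspace s) :
    star a ∈ δ.spectralSubspace s⁻¹ := by
  rw [mem_spectralSubspace] at *
  rw [map_star, ha, MaxTensor.star_tmul, groupU_inv]

/-- The *-homomorphism `δ ⊗ id : A ⊗ C*(G) → (A ⊗ C*(G)) ⊗ C*(G)`. -/
def tensorId : MaxTensor A (GroupCStar G) →⋆ₙₐ[ℂ]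
    MaxTensor (MaxTensor A (GroupCStar G)) (GroupCStar G) :=
  MaxTensor.map δ.toHom (NonUnitalStarAlgHom.id ℂ _)

theorem tensorId_tmul (a : A) (s : G) :
    δ.tensorId (MaxTensor.tmul a (groupU s)) = MaxTensor.tmul (δ.toHom a) (groupU s) :=
  MaxTensor.map_tmul _ _ _ _

theorem tensorId_toHom (a : A) : δ.tensorId (δ.toHom a) = MaxTensor.diagonal G A (δ.toHom a) :=
  (MaxTensor.assocInv_assoc _).symm.trans (congrArg MaxTensor.assocInv (δ.coassoc a))

theorem charSlice_counit_toHom (a : A) : charSlice A (counit G) (δ.toHom a) = a := by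
  have hright (y) : δ.toHom (charSlice A (counit G) y) =
      charSlice _ (counit G) (δ.tensorId y) :=
    DFunLike.congr_fun (MaxTensor.ext_tmul_groupU
      (f := (starHomL δ.toHom).comp (starHomL (charSlice A (counit G))))
      (g := (starHomL (charSlice _ (counit G))).comp (starHomL δ.tensorId)) fun a s => by
        simp only [ContinuousLinearMap.comp_apply, starHomL_apply, charSlice_counit_tmul,
          tensorId_tmul]) y
  have hdiag (y) : charSlice _ (counit G) (MaxTensor.diagonal G A y) = y :=
    DFunLike.congr_fun (MaxTensor.ext_tmul_groupU
      (f := (starHomL (charSlice _ (counit G))).comp (starHomL (MaxTensor.diagonal G A)))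
      (g := .id ℂ _) fun a s => by
        simp only [ContinuousLinearMap.comp_apply, starHomL_apply, MaxTensor.diagonal_tmul,
          charSlice_counit_tmul, ContinuousLinearMap.id_apply]) y
  apply δ.injective
  rw [hright, tensorId_toHom, hdiag]

theorem slice_toHom_mem_spectralSubspace (s : G) (a : A) :
    slice s (δ.toHom a) ∈ δ.spectralSubspace s := by
  classical
  have hright (y) : δ.toHom (slice s y) = slice s (δ.tensorId y) :=
    DFunLike.congr_fun (MaxTensor.ext_tmul_groupU (f := (starHomL δ.toHom).comp (slice s))
      (g := (slice s).comp (starHomL δ.tensorId)) fun a t => by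
        simp only [ContinuousLinearMap.comp_apply, starHomL_apply, slice_tmul, tensorId_tmul,
          apply_ite δ.toHom, map_zero]) y
  have hdiag (y) : slice s (MaxTensor.diagonal G A y) = MaxTensor.tmul (slice s y) (groupU s) :=
    DFunLike.congr_fun (MaxTensor.ext_tmul_groupU
      (f := (slice s).comp (starHomL (MaxTensor.diagonal G A)))
      (g := (MaxTensor.tmulRightL A (groupU s)).comp (slice s)) fun a t => by
        simp only [ContinuousLinearMap.comp_apply, starHomL_apply, slice_tmul,
          MaxTensor.diagonal_tmul, MaxTensor.tmulRightL_apply]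
        split_ifs with h
        · rw [h]
        · rw [MaxTensor.zero_tmul]) y
  rw [mem_spectralSubspace, hright, tensorId_toHom, hdiag]

theorem dense_span_iUnion_spectralSubspace :
    Dense (Submodule.span ℂ (⋃ s, (δ.spectralSubspace s : Set A)) : Set A) := by
  classical
  intro a
  have hdiag (y) : diagonalSlice (MaxTensor.diagonal G A y) = charSlice A (counit G) y :=
    DFunLike.congr_fun (MaxTensor.ext_tmul_groupU
      (f := diagonalSlice.comp (starHomL (MaxTensor.diagonal G A)))
      (g := starHomL (charSlice A (counit G))) fun a s => by
        simp only [ContinuousLinearMap.comp_apply, starHomL_apply, MaxTensor.diagonal_tmul,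
          diagonalSlice_tmul_tmul, if_true, charSlice_counit_tmul]) y
  have hslice (s : G) (y : MaxTensor A (GroupCStar G)) :
      diagonalSlice (MaxTensor.tmul y (groupU s)) = slice s y :=
    DFunLike.congr_fun (MaxTensor.ext_tmul_groupU
      (f := diagonalSlice.comp (MaxTensor.tmulRightL _ (groupU s))) (g := slice s) fun a t => by
        simp only [ContinuousLinearMap.comp_apply, MaxTensor.tmulRightL_apply,
          diagonalSlice_tmul_tmul, slice_tmul]) y
  have ha : diagonalSlice (δ.tensorId (δ.toHom a)) = a := by
    rw [tensorId_toHom, hdiag, charSlice_counit_toHom]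
  rw [← ha]
  refine apply_mem_of_mem_closure_span (Submodule.isClosed_topologicalClosure _)
    (diagonalSlice.comp (starHomL δ.tensorId)) ?_ (MaxTensor.dense_span_tmul_groupU (δ.toHom a))
  rintro _ ⟨b, -, _, ⟨s, rfl⟩, rfl⟩
  rw [ContinuousLinearMap.comp_apply, starHomL_apply, tensorId_tmul, hslice]
  exact Submodule.le_topologicalClosure _ (Submodule.subset_span
    (Set.mem_iUnion.mpr ⟨s, δ.slice_toHom_mem_spectralSubspace s b⟩))

end Coaction

/-! ### Characteristic functions in `C₀(G)` -/

section Chi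

variable {G : Type v} [TopologicalSpace G] [DiscreteTopology G]

theorem chi_apply [DecidableEq G] (s t : G) : chi s t = if t = s then 1 else 0 := by
  change Set.indicator {s} 1 t = _
  rw [Set.indicator_apply, if_congr Set.mem_singleton_iff rfl rfl, Pi.one_apply]

theorem isStarProjection_chi (s : G) : IsStarProjection (chi s) := by
  classical
  refine ⟨?_, ?_⟩ <;> ext t
  · simp [chi_apply]
  · simp [chi_apply, apply_ite]

theorem chi_mul_of_ne {s t : G} (h : s ≠ t) : chi s * chi t = 0 := by
  classical
  ext r
  rw [ZeroAtInftyContinuousMap.mul_apply, chi_apply, chi_apply]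
  split_ifs with hs ht
  · exact absurd (hs.symm.trans ht) h
  all_goals simp

theorem dense_span_chi : Dense (Submodule.span ℂ (Set.range (chi (G := G))) : Set C₀(G, ℂ)) := by
  classical
  intro f
  rw [Metric.mem_closure_iff]
  intro ε hε
  have hfinite : {t | ε / 2 ≤ ‖f t‖}.Finite := by
    have hlim : Filter.Tendsto f Filter.cofinite (nhds 0) :=
      Filter.cocompact_eq_cofinite G ▸ zero_at_infty f
    simpa only [Filter.eventually_cofinite, not_lt] using
      hlim.norm.eventually_lt_const (norm_zero.trans_lt (half_pos hε))
  set F : Finset G := hfinite.toFinset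
  have happrox (t : G) : (∑ s ∈ F, f s • chi s : C₀(G, ℂ)) t = if t ∈ F then f t else 0 := by
    refine (map_sum (⟨⟨fun g => g t, rfl⟩, fun _ _ => rfl⟩ : C₀(G, ℂ) →+ ℂ) _ F).trans ?_
    change ∑ s ∈ F, f s * chi s t = _
    simp [chi_apply]
  refine ⟨∑ s ∈ F, f s • chi s, Submodule.sum_mem _ fun s _ =>
    Submodule.smul_mem _ _ (Submodule.subset_span ⟨s, rfl⟩), ?_⟩
  rw [dist_eq_norm, ← ZeroAtInftyContinuousMap.norm_toBCF_eq_norm]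
  refine lt_of_le_of_lt ?_ (half_lt_self hε)
  rw [BoundedContinuousFunction.norm_le (half_pos hε).le]
  intro t
  change ‖f t - (∑ s ∈ F, f s • chi s : C₀(G, ℂ)) t‖ ≤ ε / 2
  rw [happrox]
  split_ifs with h
  · simpa using (half_pos hε).le
  · rw [sub_zero]
    exact (not_le.mp fun hle => h (hfinite.mem_toFinset.mpr hle)).le

/-- The scalar representation `f ↦ f(t)` of `C₀(G)` on `H`. -/
def evalRep (H : Type w) [NormedAddCommGroup H] [InnerProductSpace ℂ H] [CompleteSpace H] (t : G) :
    C₀(G, ℂ) →⋆ₙₐ[ℂ] (H →L[ℂ] H) where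
  toFun f := f t • 1
  map_smul' c f := by simp [mul_smul]
  map_zero' := by simp
  map_add' f g := by simp [add_smul]
  map_mul' f g := by simp [mul_smul, smul_comm (f t) (g t)]
  map_star' f := by simp [star_smul]

variable {H : Type w} [NormedAddCommGroup H] [InnerProductSpace ℂ H] [CompleteSpace H]

theorem evalRep_chi [DecidableEq G] (s t : G) (h : H) :
    evalRep H t (chi s) h = if t = s then h else 0 := by
  change chi s t • h = _
  rw [chi_apply, ite_smul, one_smul, zero_smul]

theorem isNondegenerate_evalRep (t : G) : IsNondegenerate (evalRep H t) := by
  classical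
  refine dense_univ.mono fun k _ => Submodule.subset_span ⟨chi t, k, ?_⟩
  rw [evalRep_chi, if_pos rfl]

end Chi

/-! ### The regular covariant representation -/

namespace Coaction

variable {G : Type v} [Group G] {A : Type u} [NonUnitalCStarAlgebra A] (δ : Coaction G A)

theorem regularRep_toHom_single [DecidableEq G] {H : Type w} [NormedAddCommGroup H]
    [InnerProductSpace ℂ H] [CompleteSpace H] (π : A →⋆ₙₐ[ℂ] (H →L[ℂ] H)) {s : G} {a : A}
    (ha : a ∈ δ.spectralSubspace s) (t : G) (h : H) :
    regularRep π (δ.toHom a) (lp.single (E := fun _ : G => H) 2 t h) =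
      lp.single 2 (s * t) (π a h) := by
  rw [δ.mem_spectralSubspace.mp ha, regularRep_tmul_single]

theorem isNondegenerate_regularRep {H : Type w} [NormedAddCommGroup H] [InnerProductSpace ℂ H]
    [CompleteSpace H] {π : A →⋆ₙₐ[ℂ] (H →L[ℂ] H)} (hπ : IsNondegenerate π) :
    IsNondegenerate ((regularRep π).comp δ.toHom) := by
  classical
  refine dense_of_single_mem fun t k => ?_
  set K := (Submodule.span ℂ {h : lp (fun _ : G => H) 2 |
    ∃ b k, h = (regularRep π).comp δ.toHom b k}).topologicalClosure
  have hK : IsClosed (K : Set (lp (fun _ : G => H) 2)) := Submodule.isClosed_topologicalClosure _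
  let single := lp.singleContinuousLinearMap ℂ (fun _ : G => H) 2 t
  have hspectral : ∀ s, ∀ a ∈ δ.spectralSubspace s, ∀ h, single (π a h) ∈ K := fun s a ha h => by
    refine Submodule.le_topologicalClosure _ (Submodule.subset_span
      ⟨a, lp.single (E := fun _ : G => H) 2 (s⁻¹ * t) h, ?_⟩)
    rw [NonUnitalStarAlgHom.comp_apply, δ.regularRep_toHom_single π ha, mul_inv_cancel_left]
    rfl
  have hall : ∀ a h, single (π a h) ∈ K := fun a h =>
    apply_mem_of_mem_closure_span hK
      (single.comp ((ContinuousLinearMap.apply ℂ H h).comp (starHomL π)))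
      (fun b hb => (Set.mem_iUnion.mp hb).elim fun s hs => hspectral s b hs h)
      (δ.dense_span_iUnion_spectralSubspace a)
  refine apply_mem_of_mem_closure_span hK single ?_ (hπ k)
  rintro _ ⟨a, h, rfl⟩
  exact hall a h

variable [TopologicalSpace G] [DiscreteTopology G]

/-- The covariant representation `((π ⊗ λ) ∘ δ, 1 ⊗ M)` on `ℓ²(G, H)`, where `M` is the
representation of `C₀(G)` by multiplication operators. -/
def regularCovariantRep {H : Type u} [NormedAddCommGroup H] [InnerProductSpace ℂ H]
    [CompleteSpace H] (π : A →⋆ₙₐ[ℂ] (H →L[ℂ] H)) (hπ : IsNondegenerate π) : CovariantRep δ where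
  H := lp (fun _ : G => H) 2
  π := (regularRep π).comp δ.toHom
  μ := directSumRep fun t => evalRep H t
  nondegenerate_π := δ.isNondegenerate_regularRep hπ
  nondegenerate_μ := isNondegenerate_directSumRep _ fun t => isNondegenerate_evalRep t
  covariant s t a ha := by
    classical
    rw [NonUnitalStarAlgHom.comp_apply, δ.mem_spectralSubspace.mp ha, regularRep_tmul]
    ext ξ i
    change π a (evalRep H (s⁻¹ * i) (chi t) (ξ (s⁻¹ * i))) =
      evalRep H i (chi (s * t)) (π a (ξ (s⁻¹ * i)))
    simp only [evalRep_chi, inv_mul_eq_iff_eq_mul, apply_ite (π a), map_zero]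

end Coaction

/-! ### Corners of the crossed product -/

section StarSubalgebras

/-- The compression `b ↦ φ(b) p` of a *-homomorphism by a projection commuting with its range. -/
def compress {R B D : Type*} [Monoid R] [NonUnitalNonAssocSemiring B] [DistribMulAction R B]
    [Star B] [NonUnitalSemiring D] [StarRing D] [DistribMulAction R D] [IsScalarTower R D D]
    (φ : B →⋆ₙₐ[R] D) {p : D} (hp : IsStarProjection p) (hcomm : ∀ b, Commute (φ b) p) :
    B →⋆ₙₐ[R] D where
  toFun b := φ b * p
  map_smul' c b := by rw [map_smul, smul_mul_assoc, MonoidHom.id_apply]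
  map_zero' := by rw [map_zero, zero_mul]
  map_add' a b := by rw [map_add, add_mul]
  map_mul' a b := by
    rw [map_mul, (hcomm b).symm.mul_mul_mul_comm, hp.isIdempotentElem.eq]
  map_star' b := by
    rw [star_mul, hp.isSelfAdjoint.star_eq, ← map_star, (hcomm (star b)).eq]

/-- The linear span of a set closed, up to linear combinations, under products and adjoints. -/
def spanStarSubalgebra {R D : Type*} [CommSemiring R] [StarRing R] [NonUnitalSemiring D]
    [StarRing D] [Module R D] [StarModule R D] [IsScalarTower R D D] [SMulCommClass R D D]
    (S : Set D) (hmul : ∀ x ∈ S, ∀ y ∈ S, x * y ∈ Submodule.span R S)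
    (hstar : ∀ x ∈ S, star x ∈ Submodule.span R S) : NonUnitalStarSubalgebra R D where
  __ := Submodule.span R S
  mul_mem' hx hy :=
    LinearMap.BilinMap.apply_apply_mem_of_mem_span (Submodule.span R S) S S (LinearMap.mul R D)
      hmul _ _ hx hy
  star_mem' hx :=
    (Submodule.span_le.mpr hstar : Submodule.span R S ≤
      (Submodule.span R S).comap (starLinearEquiv R (A := D)).toLinearMap) hx

end StarSubalgebras

namespace Coaction

variable {G : Type v} [Group G] [TopologicalSpace G] [DiscreteTopology G] {A : Type u}
  [NonUnitalCStarAlgebra A] (δ : Coaction G A)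

theorem isStarProjection_jG_chi (t : G) : IsStarProjection (δ.jG (chi t)) :=
  (isStarProjection_chi t).map δ.jG

theorem jG_chi_mul_of_ne {s t : G} (h : s ≠ t) : δ.jG (chi s) * δ.jG (chi t) = 0 := by
  rw [← map_mul, chi_mul_of_ne h, map_zero]

theorem jA_mul_jG_chi {s : G} {a : A} (ha : a ∈ δ.spectralSubspace s) (t : G) :
    δ.jA a * δ.jG (chi t) = δ.jG (chi (s * t)) * δ.jA a :=
  Subtype.ext <| funext fun ρ => ρ.covariant s t a ha

theorem jG_chi_mul_jA {s : G} {a : A} (ha : a ∈ δ.spectralSubspace s) (t : G) :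
    δ.jG (chi t) * δ.jA a = δ.jA a * δ.jG (chi (s⁻¹ * t)) := by
  rw [δ.jA_mul_jG_chi ha, mul_inv_cancel_left]

theorem commute_jA_jG_chi (a : δ.fixedPointAlgebra) (t : G) :
    Commute (δ.jA a) (δ.jG (chi t)) := by
  have h := δ.jA_mul_jG_chi a.2 t
  rwa [one_mul] at h

/-- The products `j_A(a) j_G(χ_t)` with `a` in a spectral subspace; their span is dense in the
crossed product. -/
def spectralGenerators : Set δ.Ambient :=
  {x | ∃ s t, ∃ a ∈ δ.spectralSubspace s, x = δ.jA a * δ.jG (chi t)}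

theorem mul_mem_span_spectralGenerators {x y : δ.Ambient} (hx : x ∈ δ.spectralGenerators)
    (hy : y ∈ δ.spectralGenerators) : x * y ∈ Submodule.span ℂ δ.spectralGenerators := by
  obtain ⟨s, t, a, ha, rfl⟩ := hx
  obtain ⟨r, q, b, hb, rfl⟩ := hy
  have hprod : δ.jA a * δ.jG (chi t) * (δ.jA b * δ.jG (chi q)) =
      δ.jA (a * b) * (δ.jG (chi (r⁻¹ * t)) * δ.jG (chi q)) := by
    rw [mul_assoc, ← mul_assoc (δ.jG (chi t)), δ.jG_chi_mul_jA hb, map_mul]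
    simp only [mul_assoc]
  rw [hprod]
  obtain rfl | hne := eq_or_ne (r⁻¹ * t) q
  · rw [(δ.isStarProjection_jG_chi _).isIdempotentElem.eq]
    exact Submodule.subset_span ⟨_, _, _, δ.mul_mem_spectralSubspace ha hb, rfl⟩
  · rw [δ.jG_chi_mul_of_ne hne, mul_zero]
    exact Submodule.zero_mem _

theorem star_mem_spectralGenerators {x : δ.Ambient} (hx : x ∈ δ.spectralGenerators) :
    star x ∈ δ.spectralGenerators := by
  obtain ⟨s, t, a, ha, rfl⟩ := hx
  have ha' := δ.star_mem_spectralSubspace ha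
  refine ⟨s⁻¹, (s⁻¹)⁻¹ * t, star a, ha', ?_⟩
  rw [star_mul, (δ.isStarProjection_jG_chi t).isSelfAdjoint.star_eq, ← map_star,
    δ.jG_chi_mul_jA ha']

theorem jA_mul_jG_mem_closure (a : A) (f : C₀(G, ℂ)) :
    δ.jA a * δ.jG f ∈ (Submodule.span ℂ δ.spectralGenerators).topologicalClosure := by
  have hclosed := (Submodule.span ℂ δ.spectralGenerators).isClosed_topologicalClosure
  let L : A →L[ℂ] C₀(G, ℂ) →L[ℂ] δ.Ambient :=
    (ContinuousLinearMap.mul ℂ δ.Ambient).bilinearComp (starHomL δ.jA) (starHomL δ.jG)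
  refine apply_mem_of_mem_closure_span hclosed (L a) ?_ (dense_span_chi f)
  rintro _ ⟨t, rfl⟩
  refine apply_mem_of_mem_closure_span hclosed (L.flip (chi t)) (fun b hb => ?_)
    (δ.dense_span_iUnion_spectralSubspace a)
  obtain ⟨s, hs⟩ := Set.mem_iUnion.mp hb
  exact Submodule.le_topologicalClosure _ (Submodule.subset_span ⟨s, t, b, hs, rfl⟩)

theorem mem_closure_of_mem_crossedProduct {x : δ.Ambient} (hx : x ∈ δ.crossedProduct) :
    x ∈ closure (Submodule.span ℂ δ.spectralGenerators : Set δ.Ambient) := by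
  let C : NonUnitalStarSubalgebra ℂ δ.Ambient := spanStarSubalgebra δ.spectralGenerators
    (fun _ hx _ hy => δ.mul_mem_span_spectralGenerators hx hy)
    (fun _ hx => Submodule.subset_span (δ.star_mem_spectralGenerators hx))
  have hle : δ.crossedProduct ≤ C.topologicalClosure := by
    refine NonUnitalStarSubalgebra.topologicalClosure_minimal _
      (NonUnitalStarAlgebra.adjoin_le ?_) (NonUnitalStarSubalgebra.isClosed_topologicalClosure _)
    rintro _ ⟨a, f, rfl⟩
    exact δ.jA_mul_jG_mem_closure a f
  exact hle hx

/-- The *-homomorphism `a ↦ j_A(a) j_G(χ_t)` on the fixed point algebra. -/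
def cornerHom (t : G) : δ.fixedPointAlgebra →⋆ₙₐ[ℂ] δ.Ambient :=
  compress (δ.jA.comp (NonUnitalStarSubalgebraClass.subtype δ.fixedPointAlgebra))
    (δ.isStarProjection_jG_chi t) fun a => δ.commute_jA_jG_chi a t

theorem cornerHom_apply (t : G) (a : δ.fixedPointAlgebra) :
    δ.cornerHom t a = δ.jA a * δ.jG (chi t) := rfl

theorem injective_cornerHom (t : G) : Function.Injective (δ.cornerHom t) := by
  classical
  refine (injective_iff_map_eq_zero _).mpr fun a ha => ?_
  obtain ⟨H, _, _, _, π, hπ, hnd⟩ := exists_faithful_rep A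
  let ρ := δ.regularCovariantRep π hnd
  have hρ : ρ.π a * ρ.μ (chi t) = 0 := congrFun (congrArg Subtype.val ha) ρ
  refine Subtype.ext (hπ ?_)
  rw [NonUnitalStarSubalgebra.coe_zero, map_zero]
  ext h
  have hsingle : regularRep π (δ.toHom a) (directSumRep (fun r => evalRep H r) (chi t)
      (lp.single (E := fun _ : G => H) 2 t h)) = 0 :=
    DFunLike.congr_fun hρ (lp.single (E := fun _ : G => H) 2 t h)
  rw [directSumRep_single, evalRep_chi, if_pos rfl, δ.regularRep_toHom_single π a.2,
    one_mul] at hsingle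
  simpa using congrArg (fun ξ : lp (fun _ : G => H) 2 => ξ t) hsingle

theorem isClosed_range_cornerHom (t : G) :
    IsClosed (LinearMap.range (δ.cornerHom t : δ.fixedPointAlgebra →ₗ[ℂ] δ.Ambient) :
      Set δ.Ambient) :=
  have : IsClosed (δ.fixedPointAlgebra : Set A) := δ.isClosed_spectralSubspace 1
  isClosed_range_of_injective (δ.injective_cornerHom t)

theorem cornerHom_mem_crossedProduct (t : G) (a : δ.fixedPointAlgebra) :
    δ.cornerHom t a ∈ δ.crossedProduct :=
  NonUnitalStarSubalgebra.le_topologicalClosure _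
    (NonUnitalStarAlgebra.subset_adjoin ℂ _ ⟨a, chi t, rfl⟩)

theorem jG_chi_mul_cornerHom_mul (t : G) (a : δ.fixedPointAlgebra) :
    δ.jG (chi t) * δ.cornerHom t a * δ.jG (chi t) = δ.cornerHom t a := by
  have hp := (δ.isStarProjection_jG_chi t).isIdempotentElem.eq
  rw [cornerHom_apply, ← mul_assoc, ← (δ.commute_jA_jG_chi a t).eq, mul_assoc, hp, mul_assoc, hp]

theorem corner_mem_range_of_mem_spectralGenerators (t : G) {x : δ.Ambient}
    (hx : x ∈ δ.spectralGenerators) :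
    δ.jG (chi t) * x * δ.jG (chi t) ∈ Set.range (δ.cornerHom t) := by
  obtain ⟨s, r, a, ha, rfl⟩ := hx
  obtain rfl | hr := eq_or_ne r t
  · obtain rfl | hs := eq_or_ne s 1
    · exact ⟨⟨a, ha⟩, (δ.jG_chi_mul_cornerHom_mul r ⟨a, ha⟩).symm⟩
    · have hne : s⁻¹ * r ≠ r := by simpa using hs
      refine ⟨0, ?_⟩
      rw [← mul_assoc, δ.jG_chi_mul_jA ha, mul_assoc (δ.jA a), δ.jG_chi_mul_of_ne hne, mul_zero,
        zero_mul, map_zero]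
  · refine ⟨0, ?_⟩
    rw [mul_assoc, mul_assoc (δ.jA a), δ.jG_chi_mul_of_ne hr, mul_zero, mul_zero, map_zero]

theorem corner_mem_range (t : G) {x : δ.Ambient} (hx : x ∈ δ.crossedProduct) :
    δ.jG (chi t) * x * δ.jG (chi t) ∈ Set.range (δ.cornerHom t) :=
  apply_mem_of_mem_closure_span (δ.isClosed_range_cornerHom t)
    (ContinuousLinearMap.mulLeftRight ℂ δ.Ambient (δ.jG (chi t)) (δ.jG (chi t)))
    (fun _ hx => δ.corner_mem_range_of_mem_spectralGenerators t hx)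
    (δ.mem_closure_of_mem_crossedProduct hx)

end Coaction

end DiscreteCoaction

end

theorem lemma4p6_general {G : Type*} [Group G] [TopologicalSpace G] [DiscreteTopology G]
    {A : Type*} [NonUnitalCStarAlgebra A] (δ : DiscreteCoaction.Coaction G A) (t : G) :
    ∃ C : NonUnitalStarSubalgebra ℂ δ.Ambient,
      (C : Set δ.Ambient) = {y | ∃ x ∈ δ.crossedProduct,
        y = δ.jG (DiscreteCoaction.chi t) * x * δ.jG (DiscreteCoaction.chi t)} ∧
      C ≤ δ.crossedProduct ∧
      Nonempty (δ.fixedPointAlgebra ≃⋆ₐ[ℂ] C) := by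
  refine ⟨NonUnitalStarAlgHom.range (δ.cornerHom t), Set.Subset.antisymm ?_ ?_, ?_,
    ⟨StarAlgEquiv.ofInjective' (δ.cornerHom t) (δ.injective_cornerHom t)⟩⟩
  · rintro _ ⟨a, rfl⟩
    exact ⟨_, δ.cornerHom_mem_crossedProduct t a, (δ.jG_chi_mul_cornerHom_mul t a).symm⟩
  · rintro _ ⟨x, hx, rfl⟩
    exact δ.corner_mem_range t hx
  · rintro _ ⟨a, rfl⟩
    exact δ.cornerHom_mem_crossedProduct t a

theorem lemma4p6 {G : Type*} [Group G] [TopologicalSpace G] [DiscreteTopology G]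
    {A : Type*} [NonUnitalCStarAlgebra A] (δ : DiscreteCoaction.Coaction G A) :
    ∃ C : NonUnitalStarSubalgebra ℂ δ.Ambient,
      (C : Set δ.Ambient) = {y | ∃ x ∈ δ.crossedProduct,
        y = δ.jG (DiscreteCoaction.chi 1) * x * δ.jG (DiscreteCoaction.chi 1)} ∧
      C ≤ δ.crossedProduct ∧
      Nonempty (δ.fixedPointAlgebra ≃⋆ₐ[ℂ] C) :=
  lemma4p6_general δ 1
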